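/- Let $\Gamma$ be a countable discrete group with identity $e$, let $\rho$ and $\lambda$, given by $\rho(\gamma)\delta_{\gamma'}=\delta_{\gamma'\gamma^{-1}}$ and $\lambda(\gamma)\delta_{\gamma'}=\delta_{\gamma\gamma'}$, be its right and left regular representations on $\ell_2(\Gamma)$, and let $\mathscr R(\Gamma)$ and $\mathscr L(\Gamma)$ be the von Neumann algebras generated by $\rho$ and $\lambda$, respectively. Let $\tau(F)=\langle F\delta_e,\delta_e\rangle$ be the trace of $\mathscr R(\Gamma)$. Let $L^1(\mathscr R(\Gamma))$ be the space of closed densely defined operators $F$ on $\ell_2(\Gamma)$ that are affiliated to $\mathscr R(\Gamma)$ (that is, commute with all unitary elements of $\mathscr L(\Gamma)$) and satisfy $\|F\|_1=\tau(|F|)<\infty$; the trace extends to it, and its linear operations are the closures of those of operators. Let $\Pi$ be a unitary representation of $\Gamma$ on a separable complex Hilbert space $\mathcal H$ that is dual integrable, with bracket map $[\cdot,\cdot]$: this is a sesquilinear map $\mathcal H\times\mathcal H\to L^1(\mathscr R(\Gamma))$ such that $$\langle\varphi,\Pi(\gamma)\psi\rangle_{\mathcal H}=\tau([\varphi,\psi]\rho(\gamma))\qquad\text{for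 all }\varphi,\psi\in\mathcal H,\ \gamma\in\Gamma .$$ Let $\psi\in\mathcal H$ and $0<A\le B<\infty$. Then: (i) The orbit $\{\Pi(\gamma)\psi\}_{\gamma\in\Gamma}$ is a frame sequence with frame bounds $A,B$, that is, $$A\|\varphi\|^2\le\sum_{\gamma\in\Gamma}|\langle\varphi,\Pi(\gamma)\psi\rangle|^2\le B\|\varphi\|^2\qquad\text{for all }\varphi\in\overline{\operatorname{span}}\{\Pi(\gamma)\psi\}_{\gamma\in\Gamma},$$ if and only if $$A\,\mathbb P_{(\operatorname{Ker}[\psi,\psi])^\perp}\le[\psi,\psi]\le B\,\mathbb P_{(\operatorname{Ker}[\psi,\psi])^\perp},$$ where $\mathbb P_W$ is the orthogonal projection of $\ell_2(\Gamma)$ onto $W$. (ii) The orbit is a Riesz sequence with Riesz bounds $A,B$, that is, $$A\sum_{\gamma}|c_\gamma|^2\le\Big\|\sum_{\gamma}c_\gamma\Pi(\gamma)\psi\Big\|^2\le B\sum_{\gamma}|c_\gamma|^2\qquad\text{for all finitely supported }c:\Gamma\to\mathbb C,$$ if and only if $$A\,\mathbb I_{\ell_2(\Gamma)}\le[\psi,\psi]\le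 B\,\mathbb I_{\ell_2(\Gamma)} .$$ Here $S\le T$ is the order of bounded operators ($\langle (T-S)x,x\rangle\ge0$ for all $x$); the inequalities include the assertion that $[\psi,\psi]$ is everywhere defined, hence bounded. -/

import Mathlib

/-! ### The regular representations and the group von Neumann algebra -/

namespace BracketFrames

open scoped lp

/-- The Hilbert space `ℓ₂(Γ)`. -/
abbrev Ell2 (Γ : Type*) : Type _ := ℓ^2(Γ, ℂ)

theorem memℓp_perm {Γ : Type*} (e : Equiv.Perm Γ) (u : Ell2 Γ) :
    Memℓp (fun γ => u (e γ)) 2 := by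
  have h := lp.memℓp u
  rw [memℓp_gen_iff (by norm_num)] at h ⊢
  exact (e.summable_iff (f := fun γ => ‖u γ‖ ^ (2 : ENNReal).toReal)).2 h

/-- The unitary `u ↦ u ∘ e` of `ℓ₂(Γ)` given by a permutation `e` of `Γ`. -/
noncomputable def permOp {Γ : Type*} (e : Equiv.Perm Γ) : Ell2 Γ ≃ₗᵢ[ℂ] Ell2 Γ where
  toFun u := ⟨fun γ => u (e γ), memℓp_perm e u⟩
  invFun u := ⟨fun γ => u (e.symm γ), memℓp_perm e.symm u⟩
  left_inv u := by ext γ; simp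
  right_inv u := by ext γ; simp
  map_add' u v := rfl
  map_smul' c u := rfl
  norm_map' u := by
    rw [lp.norm_eq_tsum_rpow (by norm_num), lp.norm_eq_tsum_rpow (by norm_num)]
    congr 1
    exact e.tsum_eq (fun γ => ‖u γ‖ ^ (2 : ENNReal).toReal)

theorem permOp_apply {Γ : Type*} (e : Equiv.Perm Γ) (u : Ell2 Γ) (γ : Γ) :
    permOp e u γ = u (e γ) := rfl

open Classical in
/-- The canonical basis vector `δ_γ` of `ℓ₂(Γ)`. -/
noncomputable def delta {Γ : Type*} (γ : Γ) : Ell2 Γ := lp.single 2 γ (1 : ℂ)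

/-- The left regular representation, `(λ(γ)u)(γ') = u(γ⁻¹γ')`. -/
noncomputable def leftReg {Γ : Type*} [Group Γ] (γ : Γ) : Ell2 Γ ≃ₗᵢ[ℂ] Ell2 Γ :=
  permOp (Equiv.mulLeft γ⁻¹)

/-- The right regular representation, `(ρ(γ)u)(γ') = u(γ'γ)`. -/
noncomputable def rightReg {Γ : Type*} [Group Γ] (γ : Γ) : Ell2 Γ ≃ₗᵢ[ℂ] Ell2 Γ :=
  permOp (Equiv.mulRight γ)

theorem permOp_delta {Γ : Type*} (e : Equiv.Perm Γ) (γ : Γ) :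
    permOp e (delta γ) = delta (e.symm γ) := by
  classical
  ext γ'
  rw [permOp_apply, delta, delta, lp.single_apply, lp.single_apply]
  by_cases h : e γ' = γ
  · subst h; simp
  · have h2 : γ' ≠ e.symm γ := fun h' => h (by simp [h'])
    rw [Pi.single_eq_of_ne h, Pi.single_eq_of_ne h2]

theorem leftReg_delta {Γ : Type*} [Group Γ] (γ γ' : Γ) :
    leftReg γ (delta γ') = delta (γ * γ') := by
  simp [leftReg, permOp_delta]

theorem rightReg_delta {Γ : Type*} [Group Γ] (γ γ' : Γ) :
    rightReg γ (delta γ') = delta (γ' * γ⁻¹) := by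
  simp [rightReg, permOp_delta]

/-- The left von Neumann algebra `𝓛(Γ)`: the one generated by the left regular representation,
that is, the double commutant of the (self-adjoint) set `{λ(γ)}`. -/
noncomputable def leftVN (Γ : Type*) [Group Γ] : Set (Ell2 Γ →L[ℂ] Ell2 Γ) :=
  Set.centralizer (Set.centralizer
    (Set.range fun γ : Γ => ((leftReg γ : Ell2 Γ ≃L[ℂ] Ell2 Γ) : Ell2 Γ →L[ℂ] Ell2 Γ)))

/-! ### Unbounded operators (`E →ₗ.[ℂ] E` is a linear operator with a domain) -/

/-- The composition `g ∘ f` on its natural domain `{x ∈ dom f | f x ∈ dom g}`. -/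
def pcomp {E : Type*} [AddCommGroup E] [Module ℂ E] (g f : E →ₗ.[ℂ] E) : E →ₗ.[ℂ] E where
  domain := (g.domain.comap f.toFun).map f.domain.subtype
  toFun :=
    { toFun := fun x => g ⟨f ⟨x, by
          obtain ⟨y, -, hy⟩ := x.2; rw [← hy]; exact y.2⟩, by
          obtain ⟨y, hy, h⟩ := x.2
          have : (⟨x.1, by rw [← h]; exact y.2⟩ : f.domain) = y := Subtype.ext h.symm
          rw [this]; exact hy⟩
      map_add' := fun x y => by
        rw [← LinearPMap.map_add]; congr 1; apply Subtype.ext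
        simp only [Submodule.coe_add]
        rw [← LinearPMap.map_add]; rfl
      map_smul' := fun c x => by
        rw [← LinearPMap.map_smul]; congr 1; apply Subtype.ext
        simp only [Submodule.coe_smul, RingHom.id_apply]
        rw [← LinearPMap.map_smul]; rfl }

theorem mem_pcomp_domain {E : Type*} [AddCommGroup E] [Module ℂ E] (g f : E →ₗ.[ℂ] E) (x : E) :
    x ∈ (pcomp g f).domain ↔ ∃ h : x ∈ f.domain, f ⟨x, h⟩ ∈ g.domain := by
  constructor
  · rintro ⟨y, hy, rfl⟩; exact ⟨y.2, hy⟩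
  · rintro ⟨h, h'⟩; exact ⟨⟨x, h⟩, h', rfl⟩

theorem pcomp_apply {E : Type*} [AddCommGroup E] [Module ℂ E] (g f : E →ₗ.[ℂ] E)
    (x : E) (hx : x ∈ (pcomp g f).domain) (h : x ∈ f.domain) (h' : f ⟨x, h⟩ ∈ g.domain) :
    pcomp g f ⟨x, hx⟩ = g ⟨f ⟨x, h⟩, h'⟩ := rfl

/-- The kernel `{x ∈ dom F | F x = 0}` as a subspace of the whole space. -/
def pker {E : Type*} [AddCommGroup E] [Module ℂ E] (F : E →ₗ.[ℂ] E) : Submodule ℂ E :=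
  (LinearMap.ker F.toFun).map F.domain.subtype

/-- A bounded operator viewed as an operator with domain the whole space. -/
def bddOp {E : Type*} [NormedAddCommGroup E] [Module ℂ E] (T : E →L[ℂ] E) :
    E →ₗ.[ℂ] E :=
  (T : E →ₗ[ℂ] E).toPMap ⊤

open scoped ComplexOrder in
/-- `T` is a positive selfadjoint operator. -/
structure IsPosSelfAdjoint {E : Type*} [NormedAddCommGroup E] [InnerProductSpace ℂ E]
    [CompleteSpace E] (T : E →ₗ.[ℂ] E) : Prop where
  selfAdjoint : IsSelfAdjoint T
  nonneg : ∀ x : T.domain, 0 ≤ inner ℂ (x : E) (T x)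

open scoped ComplexOrder in
/-- The operator order `S ≤ T`: the domain of `T` is contained in that of `S`, and
`⟨(T - S)x, x⟩ ≥ 0` there. For everywhere defined operators it says that `T - S` is positive;
if `S ≤ T` and `T` is everywhere defined, then so is `S`. -/
def OpLE {E : Type*} [NormedAddCommGroup E] [InnerProductSpace ℂ E] (S T : E →ₗ.[ℂ] E) : Prop :=
  ∀ x : T.domain, ∃ hx : (x : E) ∈ S.domain, 0 ≤ inner ℂ (x : E) (T x - S ⟨x, hx⟩)

/-- The polar decomposition `F = U|F|`, with the modulus written as `|F| = S²`, so that
`S = |F|^{1/2}`: `S` is positive selfadjoint, and `U` is the partial isometry with initial space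
`(Ker S)ᗮ = (Ker |F|)ᗮ`. For a closed densely defined `F` both `U` and `S` exist, and they are
unique, because `F*F = S⁴`. -/
structure IsPolarDecomp {E : Type*} [NormedAddCommGroup E] [InnerProductSpace ℂ E]
    [CompleteSpace E] (F : E →ₗ.[ℂ] E) (U : E →L[ℂ] E) (S : E →ₗ.[ℂ] E) : Prop where
  pos : IsPosSelfAdjoint S
  isometric : ∀ x ∈ (pker S)ᗮ, ‖U x‖ = ‖x‖
  zero_on_ker : ∀ x ∈ pker S, U x = 0
  eq : F = pcomp (bddOp U) (pcomp S S)

/-! ### Affiliated operators, the noncommutative `L¹` space, and the trace -/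

/-- The operators affiliated to the right von Neumann algebra `𝓡(Γ)`: densely defined, closed, and
commuting with every unitary element of `𝓛(Γ)`. -/
structure IsAffiliated {Γ : Type*} [Group Γ] (F : Ell2 Γ →ₗ.[ℂ] Ell2 Γ) : Prop where
  dense : Dense (F.domain : Set (Ell2 Γ))
  closed : F.IsClosed
  commutes : ∀ V ∈ leftVN Γ, V ∈ unitary (Ell2 Γ →L[ℂ] Ell2 Γ) →
    ∀ x : F.domain, ∃ hx : V x ∈ F.domain, F ⟨V x, hx⟩ = V (F x)

/-- `F ∈ L²(𝓡(Γ))`: `F` is affiliated and `τ(F*F) = ‖Fδ_e‖²` is finite, i.e. `δ_e ∈ dom F`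
(which is also the domain of `|F|`). -/
structure IsL2 {Γ : Type*} [Group Γ] (F : Ell2 Γ →ₗ.[ℂ] Ell2 Γ) : Prop where
  affiliated : IsAffiliated F
  delta_mem : delta (1 : Γ) ∈ F.domain

/-- `F ∈ L¹(𝓡(Γ))`: `F` is affiliated and `‖F‖₁ = τ(|F|) = ‖|F|^{1/2} δ_e‖²` is finite, i.e.
`S = |F|^{1/2}` belongs to `L²(𝓡(Γ))`. -/
structure IsL1 {Γ : Type*} [Group Γ] (F : Ell2 Γ →ₗ.[ℂ] Ell2 Γ) : Prop where
  affiliated : IsAffiliated F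
  finite_trace : ∃ p : (Ell2 Γ →L[ℂ] Ell2 Γ) × (Ell2 Γ →ₗ.[ℂ] Ell2 Γ),
    IsPolarDecomp F p.1 p.2 ∧ IsL2 p.2

open Classical in
/-- For `F` with polar decomposition `F = U S²`, the number `⟨F u, v⟩` in the sense of forms, i.e.
`⟨S u, S U* v⟩`, for `u` and `U* v` in the domain of `S`. It is `⟨F u, v⟩` when `u ∈ dom F`. -/
noncomputable def formValue {E : Type*} [NormedAddCommGroup E] [InnerProductSpace ℂ E]
    [CompleteSpace E] (U : E →L[ℂ] E) (S : E →ₗ.[ℂ] E) (u v : E) : ℂ :=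
  if h : u ∈ S.domain ∧ ContinuousLinearMap.adjoint U v ∈ S.domain then
    inner ℂ (S ⟨ContinuousLinearMap.adjoint U v, h.2⟩) (S ⟨u, h.1⟩)
  else 0

open Classical in
/-- The Fourier coefficient `τ(F ρ(γ)) = ⟨F ρ(γ) δ_e, δ_e⟩` of `F ∈ L¹(𝓡(Γ))`, where `τ` is the
extension of the trace `τ(F) = ⟨F δ_e, δ_e⟩` of `𝓡(Γ)` to `L¹(𝓡(Γ))`. Since `δ_e` need not be in
the domain of `F`, the inner product is taken in the sense of forms; `ρ(γ) δ_e` and `U* δ_e` are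
always in the domain of `|F|^{1/2}`, as `τ(|F|)` and `τ(|F*|) = τ(U|F|U*)` are finite. -/
noncomputable def fourierCoeff {Γ : Type*} [Group Γ] (F : Ell2 Γ →ₗ.[ℂ] Ell2 Γ) (γ : Γ) : ℂ :=
  if h : IsL1 F then
    formValue h.finite_trace.choose.1 h.finite_trace.choose.2
      (rightReg γ (delta 1)) (delta 1)
  else 0

/-- In the sense of forms `⟨F u, v⟩` is the inner product of `F u` and `v` if `u ∈ dom F`. -/
theorem formValue_eq {E : Type*} [NormedAddCommGroup E] [InnerProductSpace ℂ E]
    [CompleteSpace E] {F : E →ₗ.[ℂ] E} {U : E →L[ℂ] E} {S : E →ₗ.[ℂ] E}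
    (hp : IsPolarDecomp F U S) (u v : E) (hu : u ∈ F.domain)
    (hv : ContinuousLinearMap.adjoint U v ∈ S.domain) :
    formValue U S u v = inner ℂ v (F ⟨u, hu⟩) := by
  obtain rfl := hp.eq
  obtain ⟨h1, -⟩ := (mem_pcomp_domain _ _ _).1 hu
  obtain ⟨h2, h3⟩ := (mem_pcomp_domain _ _ _).1 h1
  rw [formValue, dif_pos ⟨h2, hv⟩]
  have h4 : pcomp (bddOp U) (pcomp S S) ⟨u, hu⟩ = U (S ⟨S ⟨u, h2⟩, h3⟩) := rfl
  rw [h4, ← ContinuousLinearMap.adjoint_inner_left]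
  have hf : S.IsFormalAdjoint S := by
    have h := LinearPMap.adjoint_isFormalAdjoint (T := S) hp.pos.selfAdjoint.dense_domain
    have h5 : S.adjoint = S := hp.pos.selfAdjoint
    rwa [h5] at h
  exact hf ⟨_, hv⟩ ⟨_, h3⟩

/-- On everywhere defined (hence bounded) operators, `fourierCoeff F γ` is literally
`⟨F ρ(γ) δ_e, δ_e⟩`. -/
theorem fourierCoeff_eq {Γ : Type*} [Group Γ] {F : Ell2 Γ →ₗ.[ℂ] Ell2 Γ} (hF : IsL1 F)
    (htop : F.domain = ⊤) (γ : Γ) :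
    fourierCoeff F γ =
      inner ℂ (delta (1 : Γ)) (F ⟨rightReg γ (delta 1), htop ▸ Submodule.mem_top⟩) := by
  rw [fourierCoeff, dif_pos hF]
  have hp := hF.finite_trace.choose_spec.1
  refine formValue_eq hp _ _ _ ?_
  have h : ContinuousLinearMap.adjoint hF.finite_trace.choose.1 (delta 1) ∈ F.domain :=
    htop ▸ Submodule.mem_top
  have heq := congrArg LinearPMap.domain hp.eq
  replace h := (congrArg (ContinuousLinearMap.adjoint hF.finite_trace.choose.1 (delta 1) ∈ ·)
    heq).mp h
  obtain ⟨h1, -⟩ := (mem_pcomp_domain _ _ _).1 h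
  exact ((mem_pcomp_domain _ _ _).1 h1).1

/-! ### Bracket maps -/

/-- `b` is an operator bracket map for the unitary representation `Π` of `Γ` on `H`: a sesquilinear
map `H × H → L¹(𝓡(Γ))` with `⟨φ, Π(γ)ψ⟩ = τ(b(φ,ψ) ρ(γ))`. Sums and scalar multiples of elements
of `L¹(𝓡(Γ))` are, as usual, the closures of the sums and multiples as operators. Mathlib's
`inner ℂ x y`, linear in `y`, is the `⟨y, x⟩` of this comment. -/
structure IsBracketMap {Γ H : Type*} [Group Γ] [NormedAddCommGroup H] [InnerProductSpace ℂ H]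
    [CompleteSpace H] (rep : Γ →* unitary (H →L[ℂ] H)) (b : H → H → (Ell2 Γ →ₗ.[ℂ] Ell2 Γ)) :
    Prop where
  isL1 : ∀ φ ψ, IsL1 (b φ ψ)
  add_left : ∀ φ φ' ψ, b (φ + φ') ψ = (b φ ψ + b φ' ψ).closure
  smul_left : ∀ (c : ℂ) φ ψ, b (c • φ) ψ = (c • b φ ψ).closure
  add_right : ∀ φ ψ ψ', b φ (ψ + ψ') = (b φ ψ + b φ ψ').closure
  smul_right : ∀ (c : ℂ) φ ψ, b φ (c • ψ) = (star c • b φ ψ).closure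
  inner_eq : ∀ φ ψ γ, inner ℂ ((rep γ : H →L[ℂ] H) ψ) φ = fourierCoeff (b φ ψ) γ

/-! ### Frame sequences and Riesz sequences -/

/-- The family `v` is a frame sequence with frame bounds `A`, `B`. -/
def IsFrameSequence {ι H : Type*} [NormedAddCommGroup H] [InnerProductSpace ℂ H]
    (v : ι → H) (A B : ℝ) : Prop :=
  ∀ φ ∈ (Submodule.span ℂ (Set.range v)).topologicalClosure,
    Summable (fun j => ‖inner ℂ (v j) φ‖ ^ 2) ∧
      A * ‖φ‖ ^ 2 ≤ ∑' j, ‖inner ℂ (v j) φ‖ ^ 2 ∧ ∑' j, ‖inner ℂ (v j) φ‖ ^ 2 ≤ B * ‖φ‖ ^ 2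

/-- The family `v` is a Riesz sequence with Riesz bounds `A`, `B`. -/
def IsRieszSequence {ι H : Type*} [NormedAddCommGroup H] [InnerProductSpace ℂ H]
    (v : ι → H) (A B : ℝ) : Prop :=
  ∀ c : ι →₀ ℂ, A * (∑ j ∈ c.support, ‖c j‖ ^ 2) ≤ ‖∑ j ∈ c.support, c j • v j‖ ^ 2 ∧
    ‖∑ j ∈ c.support, c j • v j‖ ^ 2 ≤ B * (∑ j ∈ c.support, ‖c j‖ ^ 2)

end BracketFrames

namespace BracketFrames

open scoped lp

/-! ### Operators on `ℓ₂(Γ)` commuting with the regular representations -/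

/-! Put `F = b ψ ψ` and `v γ = Π(γ)ψ`. If the synthesis operator `T δ_γ = v γ` is bounded on
`ℓ₂(Γ)`, then the bracket identity says that the Gram matrix of `v`, that is, the matrix of `T*T`,
has the Fourier coefficients of `F` as its entries. Once `F = T*T` is known, both equivalences are
Hilbert space theory. The form of `F` at `x` is `‖Tx‖²`, so (ii) compares `‖Tx‖²` with `‖x‖²`. For
(i), the frame inequalities bound `T*` on the closure of the range of `T`, and `bounds_adjoint_iff`
turns them into the same bounds for `T` on `(Ker T)ᗮ = (Ker F)ᗮ`. Either side of each equivalence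
provides a bounded `T`: the sequence conditions through a Bessel inequality, the operator
inequalities because they make `F` everywhere defined and bounded above.

The main point is `F = T*T` (`IsL1.eq_bddOp`), since a priori `F` is unbounded and its coefficients
are defined only as form values `⟨S ρ(γ)δ_e, S U*δ_e⟩`, where `F = US²`. Equal coefficients give
equal forms on finitely supported vectors, so these must be a core for `S` and for `S U*`. This is
`LeftInvariant.eq_orbitGraph`: a closed left invariant graph over `δ_e` is generated by the
translates of one pair. It rests on the commutation theorem `CommutesLeft.comm`, and on the fact
that `Xδ_e`, for `X` commuting with left translations, is also `Yδ_e` for some `Y` commuting with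
right ones. The projection onto such a graph has entries commuting with left translations, so both
facts apply to it. The forms of `F` and `T*T` then agree on their full domains, and selfadjointness
of `S` gives `F = T*T`. -/

theorem inner_delta_left {Γ : Type*} (γ : Γ) (u : Ell2 Γ) : inner ℂ (delta γ) u = u γ := by
  classical
  have h := lp.inner_single_left (𝕜 := ℂ) γ (1 : ℂ) u
  rw [delta]
  convert h using 1
  simp

theorem span_delta_orthogonal {Γ : Type*} :
    (Submodule.span ℂ (Set.range (delta : Γ → Ell2 Γ)))ᗮ = ⊥ := by
  rw [Submodule.eq_bot_iff]
  intro u hu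
  ext γ
  rw [← inner_delta_left]
  exact (Submodule.mem_orthogonal _ _).1 hu _ (Submodule.subset_span ⟨γ, rfl⟩)

theorem topologicalClosure_span_delta {Γ : Type*} :
    (Submodule.span ℂ (Set.range (delta : Γ → Ell2 Γ))).topologicalClosure = ⊤ :=
  Submodule.topologicalClosure_eq_top_iff.2 span_delta_orthogonal

theorem dense_span_delta {Γ : Type*} :
    Dense (Submodule.span ℂ (Set.range (delta : Γ → Ell2 Γ)) : Set (Ell2 Γ)) :=
  Submodule.dense_iff_topologicalClosure_eq_top.2 topologicalClosure_span_delta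

theorem clm_ext_delta {Γ F : Type*} [NormedAddCommGroup F] [NormedSpace ℂ F]
    {S T : Ell2 Γ →L[ℂ] F} (h : ∀ γ, S (delta γ) = T (delta γ)) : S = T :=
  ContinuousLinearMap.ext_on dense_span_delta (by rintro _ ⟨γ, rfl⟩; exact h γ)

theorem apply_eq_tsum {Γ : Type*} (X : Ell2 Γ →L[ℂ] Ell2 Γ) (u : Ell2 Γ) (b : Γ) :
    X u b = ∑' γ, u γ * X (delta γ) b := by
  rw [← inner_delta_left, ← ContinuousLinearMap.adjoint_inner_left, lp.inner_eq_tsum]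
  refine tsum_congr fun γ => ?_
  rw [← inner_delta_left γ (ContinuousLinearMap.adjoint X (delta b)),
    ContinuousLinearMap.adjoint_inner_right, ← inner_delta_left b, RCLike.inner_apply,
    inner_conj_symm]

/-- The operator `X` commutes with the left regular representation. -/
def CommutesLeft {Γ : Type*} [Group Γ] (X : Ell2 Γ →L[ℂ] Ell2 Γ) : Prop :=
  ∀ γ u, X (leftReg γ u) = leftReg γ (X u)

/-- The operator `X` commutes with the right regular representation. -/
def CommutesRight {Γ : Type*} [Group Γ] (X : Ell2 Γ →L[ℂ] Ell2 Γ) : Prop :=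
  ∀ γ u, X (rightReg γ u) = rightReg γ (X u)

section GroupOps

variable {Γ : Type*} [Group Γ]

theorem leftReg_apply (γ : Γ) (u : Ell2 Γ) (a : Γ) : leftReg γ u a = u (γ⁻¹ * a) := rfl

theorem rightReg_apply (γ : Γ) (u : Ell2 Γ) (a : Γ) : rightReg γ u a = u (a * γ) := rfl

theorem CommutesLeft.apply_delta {X : Ell2 Γ →L[ℂ] Ell2 Γ} (hX : CommutesLeft X) (γ b : Γ) :
    X (delta γ) b = X (delta 1) (γ⁻¹ * b) := by
  rw [← leftReg_apply, ← hX, leftReg_delta, mul_one]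

theorem CommutesRight.apply_delta {Y : Ell2 Γ →L[ℂ] Ell2 Γ} (hY : CommutesRight Y) (a γ : Γ) :
    Y (delta a) γ = Y (delta 1) (γ * a⁻¹) := by
  rw [← rightReg_apply, ← hY, rightReg_delta, inv_inv, one_mul]

/-- The commutants of the two regular representations commute with each other. -/
theorem CommutesLeft.comm {X Y : Ell2 Γ →L[ℂ] Ell2 Γ} (hX : CommutesLeft X)
    (hY : CommutesRight Y) (u : Ell2 Γ) : X (Y u) = Y (X u) := by
  suffices h : X ∘L Y = Y ∘L X from DFunLike.congr_fun h u
  refine clm_ext_delta fun a => ?_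
  ext b
  rw [ContinuousLinearMap.comp_apply, ContinuousLinearMap.comp_apply, apply_eq_tsum X,
    apply_eq_tsum Y]
  -- Both matrix entries are convolution sums of the kernels `X δ_e` and `Y δ_e`; the substitution
  -- `γ ↦ bγ⁻¹a` carries one to the other.
  let e : Equiv.Perm Γ := ((Equiv.inv Γ).trans (Equiv.mulLeft b)).trans (Equiv.mulRight a)
  rw [← e.tsum_eq]
  refine tsum_congr fun γ => ?_
  rw [hX.apply_delta (e γ), hY.apply_delta a, hX.apply_delta a, hY.apply_delta γ]
  simp [e, mul_assoc, mul_comm]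

theorem CommutesLeft.adjoint {X : Ell2 Γ →L[ℂ] Ell2 Γ} (hX : CommutesLeft X) :
    CommutesLeft (ContinuousLinearMap.adjoint X) := by
  intro γ u
  refine ext_inner_left ℂ fun v => ?_
  obtain ⟨w, rfl⟩ := (leftReg γ).surjective v
  rw [ContinuousLinearMap.adjoint_inner_right, hX, LinearIsometryEquiv.inner_map_map,
    LinearIsometryEquiv.inner_map_map, ContinuousLinearMap.adjoint_inner_right]

/-- The antiunitary involution `(Ju)(γ) = conj (u(γ⁻¹))`. -/
noncomputable def conjInv : Ell2 Γ ≃ₗᵢ⋆[ℂ] Ell2 Γ :=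
  (permOp (Equiv.inv Γ)).trans (starₗᵢ ℂ)

theorem conjInv_apply (u : Ell2 Γ) (γ : Γ) : conjInv u γ = star (u γ⁻¹) := rfl

theorem conjInv_delta_one : conjInv (delta (1 : Γ)) = delta 1 := by
  classical
  ext γ
  rw [conjInv_apply, delta, lp.single_apply, lp.single_apply]
  by_cases h : γ = 1
  · subst h; simp
  · rw [Pi.single_eq_of_ne h, Pi.single_eq_of_ne (by simpa using h), star_zero]

theorem conjInv_rightReg (γ : Γ) (u : Ell2 Γ) : conjInv (rightReg γ u) = leftReg γ (conjInv u) := by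
  ext a
  simp [conjInv_apply, rightReg_apply, leftReg_apply]

theorem conjInv_leftReg (γ : Γ) (u : Ell2 Γ) : conjInv (leftReg γ u) = rightReg γ (conjInv u) := by
  ext a
  simp [conjInv_apply, rightReg_apply, leftReg_apply]

/-- The operator `JXJ`. -/
noncomputable def flip (X : Ell2 Γ →L[ℂ] Ell2 Γ) : Ell2 Γ →L[ℂ] Ell2 Γ :=
  ((conjInv : Ell2 Γ ≃ₗᵢ⋆[ℂ] Ell2 Γ) : Ell2 Γ →SL[starRingEnd ℂ] Ell2 Γ).comp
    (X.comp ((conjInv : Ell2 Γ ≃ₗᵢ⋆[ℂ] Ell2 Γ) : Ell2 Γ →SL[starRingEnd ℂ] Ell2 Γ))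

theorem flip_apply (X : Ell2 Γ →L[ℂ] Ell2 Γ) (u : Ell2 Γ) :
    flip X u = conjInv (X (conjInv u)) := rfl

theorem CommutesLeft.flip {X : Ell2 Γ →L[ℂ] Ell2 Γ} (hX : CommutesLeft X) :
    CommutesRight (flip X) := by
  intro γ u
  rw [flip_apply, flip_apply, conjInv_rightReg, hX, conjInv_leftReg]

theorem CommutesLeft.flip_delta_one {X : Ell2 Γ →L[ℂ] Ell2 Γ} (hX : CommutesLeft X) :
    BracketFrames.flip X (delta 1) = ContinuousLinearMap.adjoint X (delta 1) := by
  ext γ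
  rw [flip_apply, conjInv_delta_one, conjInv_apply, ← inner_delta_left γ,
    ContinuousLinearMap.adjoint_inner_right, ← inner_conj_symm, inner_delta_left,
    hX.apply_delta γ 1, mul_one]
  rfl

/-- The vector `X δ_e`, for `X` in the right von Neumann algebra, is also the image of `δ_e` under
an operator in the left one. -/
theorem CommutesLeft.exists_commutesRight {X : Ell2 Γ →L[ℂ] Ell2 Γ} (hX : CommutesLeft X) :
    ∃ Y : Ell2 Γ →L[ℂ] Ell2 Γ, CommutesRight Y ∧ Y (delta 1) = X (delta 1) := by
  refine ⟨_, hX.adjoint.flip, ?_⟩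
  rw [hX.adjoint.flip_delta_one, ContinuousLinearMap.adjoint_adjoint]

end GroupOps

/-! ### Closed subspaces of `E × E` and their projections -/

section Projection

variable {E : Type*} [NormedAddCommGroup E] [InnerProductSpace ℂ E]

theorem eq_zero_of_inner_add_inner_self {p q : E} (h : inner ℂ p p + inner ℂ q q = 0) :
    p = 0 ∧ q = 0 := by
  rw [inner_self_eq_norm_sq_to_K, inner_self_eq_norm_sq_to_K] at h
  have h' : ‖p‖ ^ 2 + ‖q‖ ^ 2 = 0 := by
    have := congrArg Complex.re h
    simpa [← Complex.ofReal_pow] using this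
  constructor <;> rw [← norm_eq_zero] <;> nlinarith [sq_nonneg ‖p‖, sq_nonneg ‖q‖]

/-- Uniqueness of the orthogonal projection onto `K`, stated componentwise because `E × E` carries
the sup norm and no inner product. -/
theorem eq_of_inner_sub_eq_zero {K : Submodule ℂ (E × E)} {x y p q p' q' : E}
    (h : (p, q) ∈ K) (h' : (p', q') ∈ K)
    (ho : ∀ w ∈ K, inner ℂ w.1 (x - p) + inner ℂ w.2 (y - q) = 0)
    (ho' : ∀ w ∈ K, inner ℂ w.1 (x - p') + inner ℂ w.2 (y - q') = 0) : p = p' ∧ q = q' := by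
  have hw : (p - p', q - q') ∈ K := K.sub_mem h h'
  have h1 := ho _ hw
  have h2 := ho' _ hw
  have h3 : inner ℂ (p - p') (p - p') + inner ℂ (q - q') (q - q') = 0 := by
    have e1 : p - p' = (x - p') - (x - p) := by abel
    have e2 : q - q' = (y - q') - (y - q) := by abel
    calc _ = inner ℂ (p - p') ((x - p') - (x - p)) + inner ℂ (q - q') ((y - q') - (y - q)) := by
            rw [← e1, ← e2]
      _ = 0 := by
            rw [inner_sub_right _ (x - p'), inner_sub_right _ (y - q')]
            linear_combination h2 - h1
  obtain ⟨h4, h5⟩ := eq_zero_of_inner_add_inner_self h3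
  exact ⟨sub_eq_zero.1 h4, sub_eq_zero.1 h5⟩

/-- The matrix entries of the orthogonal projection onto a closed subspace of `E × E`. -/
theorem exists_projection_entries [CompleteSpace E] {K : Submodule ℂ (E × E)}
    (hK : IsClosed (K : Set (E × E))) :
    ∃ a b c d : E →L[ℂ] E, ∀ x y : E, (a x + c y, b x + d y) ∈ K ∧
      ∀ w ∈ K, inner ℂ w.1 (x - (a x + c y)) + inner ℂ w.2 (y - (b x + d y)) = 0 := by
  -- The projection is taken in the Hilbert sum `WithLp 2 (E × E)`, which has the same topology, and
  -- carried back.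
  let e := WithLp.prodContinuousLinearEquiv 2 ℂ E E
  let K' : Submodule ℂ (WithLp 2 (E × E)) := K.comap (e : WithLp 2 (E × E) →ₗ[ℂ] E × E)
  have hK' : IsClosed (K' : Set (WithLp 2 (E × E))) := hK.preimage e.continuous
  have : CompleteSpace K' := hK'.completeSpace_coe
  let P : E × E →L[ℂ] E × E :=
    (e : WithLp 2 (E × E) →L[ℂ] E × E) ∘L K'.starProjection ∘L
      (e.symm : E × E →L[ℂ] WithLp 2 (E × E))
  let i := ContinuousLinearMap.inl ℂ E E
  let j := ContinuousLinearMap.inr ℂ E E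
  let f := ContinuousLinearMap.fst ℂ E E
  let s := ContinuousLinearMap.snd ℂ E E
  refine ⟨f ∘L P ∘L i, s ∘L P ∘L i, f ∘L P ∘L j, s ∘L P ∘L j, fun x y => ?_⟩
  have hxy : P (x, y) = ((f ∘L P ∘L i) x + (f ∘L P ∘L j) y, (s ∘L P ∘L i) x + (s ∘L P ∘L j) y) := by
    have h1 : (x, y) = i x + j y := by simp [i, j]
    rw [h1, map_add]
    rfl
  rw [← hxy]
  refine ⟨K'.starProjection_apply_mem (e.symm (x, y)), fun w hw => ?_⟩
  have h2 : inner ℂ (e.symm w) (e.symm (x, y) - K'.starProjection (e.symm (x, y))) = 0 :=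
    (Submodule.mem_orthogonal _ _).1 (K'.sub_starProjection_mem_orthogonal _) _ hw
  rw [WithLp.prod_inner_apply] at h2
  have h3 : (P (x, y)).1 = (f ∘L P ∘L i) x + (f ∘L P ∘L j) y := congrArg Prod.fst hxy
  have h4 : (P (x, y)).2 = (s ∘L P ∘L i) x + (s ∘L P ∘L j) y := congrArg Prod.snd hxy
  rw [← h3, ← h4]
  exact h2

end Projection

section Invariant

variable {Γ : Type*} [Group Γ]

/-- A subspace of `ℓ₂(Γ) × ℓ₂(Γ)` invariant under the diagonal left regular representation. -/
def LeftInvariant (K : Submodule ℂ (Ell2 Γ × Ell2 Γ)) : Prop :=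
  ∀ γ, ∀ w ∈ K, (leftReg γ w.1, leftReg γ w.2) ∈ K

theorem leftReg_leftReg_inv (γ : Γ) (u : Ell2 Γ) : leftReg γ (leftReg γ⁻¹ u) = u := by
  ext a; simp [leftReg_apply]

/-- The translations are unitary and preserve `K`, so by uniqueness the projection commutes with
them, and hence so does each of its entries. -/
theorem LeftInvariant.exists_projection_entries {K : Submodule ℂ (Ell2 Γ × Ell2 Γ)}
    (hK : IsClosed (K : Set (Ell2 Γ × Ell2 Γ))) (hinv : LeftInvariant K) :
    ∃ a b c d : Ell2 Γ →L[ℂ] Ell2 Γ, CommutesLeft a ∧ CommutesLeft b ∧ CommutesLeft c ∧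
      CommutesLeft d ∧ (∀ w ∈ K, a w.1 + c w.2 = w.1 ∧ b w.1 + d w.2 = w.2) ∧
      ∀ x y, (a x + c y, b x + d y) ∈ K ∧
        ∀ w ∈ K, inner ℂ w.1 (x - (a x + c y)) + inner ℂ w.2 (y - (b x + d y)) = 0 := by
  obtain ⟨a, b, c, d, h⟩ := BracketFrames.exists_projection_entries hK
  have key : ∀ γ x y, leftReg γ (a x + c y) = a (leftReg γ x) + c (leftReg γ y) ∧
      leftReg γ (b x + d y) = b (leftReg γ x) + d (leftReg γ y) := by
    intro γ x y
    refine eq_of_inner_sub_eq_zero (x := leftReg γ x) (y := leftReg γ y)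
      (hinv γ _ (h x y).1) (h _ _).1 (fun w hw => ?_) (h _ _).2
    have h1 := (h x y).2 _ (hinv γ⁻¹ w hw)
    rw [← LinearIsometryEquiv.inner_map_map (leftReg γ),
      ← LinearIsometryEquiv.inner_map_map (leftReg γ) (leftReg γ⁻¹ w.2)] at h1
    simpa only [leftReg_leftReg_inv, map_sub] using h1
  refine ⟨a, b, c, d, fun γ x => ?_, fun γ x => ?_, fun γ x => ?_, fun γ x => ?_,
    fun w hw => ?_, h⟩
  · simpa using (key γ x 0).1.symm
  · simpa using (key γ x 0).2.symm
  · simpa using (key γ 0 x).1.symm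
  · simpa using (key γ 0 x).2.symm
  · exact eq_of_inner_sub_eq_zero (x := w.1) (y := w.2) (h _ _).1 hw (h _ _).2 (by simp)

/-- A closed left invariant subspace is invariant under the whole left von Neumann algebra. -/
theorem LeftInvariant.map_mem {K : Submodule ℂ (Ell2 Γ × Ell2 Γ)}
    (hK : IsClosed (K : Set (Ell2 Γ × Ell2 Γ))) (hinv : LeftInvariant K)
    {Y : Ell2 Γ →L[ℂ] Ell2 Γ} (hY : CommutesRight Y) {x y : Ell2 Γ} (h : (x, y) ∈ K) :
    (Y x, Y y) ∈ K := by
  obtain ⟨a, b, c, d, ha, hb, hc, hd, hfix, hmem⟩ := hinv.exists_projection_entries hK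
  have h1 := (hmem (Y x) (Y y)).1
  rw [ha.comm hY, hb.comm hY, hc.comm hY, hd.comm hY, ← map_add, ← map_add] at h1
  obtain ⟨h2, h3⟩ := hfix _ h
  rwa [h2, h3] at h1

/-- The closed span of the left translates of `(δ_e, s)`. -/
noncomputable def orbitGraph (s : Ell2 Γ) : Submodule ℂ (Ell2 Γ × Ell2 Γ) :=
  (Submodule.span ℂ (Set.range fun γ : Γ => (delta γ, leftReg γ s))).topologicalClosure

theorem leftReg_mul (γ γ' : Γ) (u : Ell2 Γ) : leftReg (γ * γ') u = leftReg γ (leftReg γ' u) := by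
  ext a; simp [leftReg_apply, mul_assoc]

theorem leftReg_one (u : Ell2 Γ) : leftReg (1 : Γ) u = u := by
  ext a; simp [leftReg_apply]

theorem isClosed_orbitGraph (s : Ell2 Γ) : IsClosed (orbitGraph s : Set (Ell2 Γ × Ell2 Γ)) :=
  Submodule.isClosed_topologicalClosure _

theorem mem_orbitGraph (s : Ell2 Γ) (γ : Γ) : (delta γ, leftReg γ s) ∈ orbitGraph s :=
  Submodule.le_topologicalClosure _ (Submodule.subset_span ⟨γ, rfl⟩)

theorem orbitGraph_le {s : Ell2 Γ} {K : Submodule ℂ (Ell2 Γ × Ell2 Γ)}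
    (hK : IsClosed (K : Set (Ell2 Γ × Ell2 Γ))) (h : ∀ γ, (delta γ, leftReg γ s) ∈ K) :
    orbitGraph s ≤ K :=
  Submodule.topologicalClosure_minimal _
    (Submodule.span_le.2 (by rintro _ ⟨γ, rfl⟩; exact h γ)) hK

theorem leftInvariant_orbitGraph (s : Ell2 Γ) : LeftInvariant (orbitGraph s) := by
  intro γ w hw
  let V : Ell2 Γ →L[ℂ] Ell2 Γ := ((leftReg γ : Ell2 Γ ≃L[ℂ] Ell2 Γ) : Ell2 Γ →L[ℂ] Ell2 Γ)
  have h : orbitGraph s ≤ (orbitGraph s).comap (V.prodMap V : Ell2 Γ × Ell2 Γ →ₗ[ℂ] _) := by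
    refine orbitGraph_le ((isClosed_orbitGraph s).preimage (V.prodMap V).continuous) fun γ' => ?_
    have h1 := mem_orbitGraph s (γ * γ')
    rw [leftReg_mul, ← leftReg_delta] at h1
    exact h1
  exact h hw

/-- If a closed operator commuting with the left translations is defined on `δ_e`, then the finitely
supported vectors form a core for it. -/
theorem LeftInvariant.eq_orbitGraph {K : Submodule ℂ (Ell2 Γ × Ell2 Γ)}
    (hK : IsClosed (K : Set (Ell2 Γ × Ell2 Γ))) (hinv : LeftInvariant K)
    (hgraph : ∀ y, ((0, y) : Ell2 Γ × Ell2 Γ) ∈ K → y = 0) {s : Ell2 Γ} (hs : (delta 1, s) ∈ K) :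
    K = orbitGraph s := by
  have hle : orbitGraph s ≤ K := orbitGraph_le hK fun γ => by
    have h := hinv γ _ hs
    simpa [leftReg_delta] using h
  refine le_antisymm ?_ hle
  obtain ⟨a, b, c, d, ha, hb, hc, hd, hfix, hmem⟩ := hinv.exists_projection_entries hK
  have hab : ∀ x, (a x, b x) ∈ K := fun x => by simpa using (hmem x 0).1
  have hcl := isClosed_orbitGraph s
  -- Writing `a δ_e = Y δ_e` with `Y` in the commutant of the right translations puts `(Y δ_e, Y s)`
  -- in the orbit graph. As `K` is a graph, its second component must be `b δ_e`.
  have hone : (a (delta 1), b (delta 1)) ∈ orbitGraph s := by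
    obtain ⟨Y, hY, hYa⟩ := ha.exists_commutesRight
    have h1 : (Y (delta 1), Y s) ∈ orbitGraph s :=
      (leftInvariant_orbitGraph s).map_mem hcl hY
        (by simpa [leftReg_one] using mem_orbitGraph s (1 : Γ))
    have h2 := hgraph (b (delta 1) - Y s) (by simpa [hYa] using K.sub_mem (hab (delta 1)) (hle h1))
    rwa [hYa, ← sub_eq_zero.1 h2] at h1
  have hall : ∀ x, (a x, b x) ∈ orbitGraph s := by
    intro x
    have h1 : (Submodule.span ℂ (Set.range (delta : Γ → Ell2 Γ))).topologicalClosure ≤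
        (orbitGraph s).comap (a.prod b : Ell2 Γ →ₗ[ℂ] Ell2 Γ × Ell2 Γ) := by
      refine Submodule.topologicalClosure_minimal _ (Submodule.span_le.2 ?_)
        (hcl.preimage (a.prod b).continuous)
      rintro _ ⟨γ, rfl⟩
      have h2 := leftInvariant_orbitGraph s γ _ hone
      simp only [← ha γ, ← hb γ, leftReg_delta, mul_one] at h2
      exact h2
    rw [topologicalClosure_span_delta] at h1
    exact h1 Submodule.mem_top
  -- The difference of a vector of `K` and its projection onto the orbit graph is orthogonal to
  -- every `(a x, b x)`, the projection of `(x, 0)` onto `K`. So its first component is orthogonal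
  -- to every `x`, and a graph vector with zero first component vanishes.
  obtain ⟨a', b', c', d', h'⟩ := BracketFrames.exists_projection_entries hcl
  rintro ⟨u, v⟩ huv
  obtain ⟨h1, h2⟩ := h' u v
  have h3 := K.sub_mem huv (hle h1)
  have h4 : u - (a' u + c' v) = 0 := by
    refine ext_inner_left ℂ fun x => ?_
    have h5 := (hmem x 0).2 _ h3
    have h6 := h2 _ (hall x)
    rw [← inner_conj_symm, ← inner_conj_symm (b x), ← map_add, map_eq_zero] at h6
    simp only [map_zero, add_zero, zero_sub, inner_neg_right, inner_sub_right, Prod.fst_sub,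
      Prod.snd_sub] at h5
    rw [inner_zero_right, ← inner_conj_symm, map_eq_zero]
    linear_combination h5 + h6
  have h7 : v - (b' u + d' v) = 0 := hgraph _ (by
    have : ((u, v) : Ell2 Γ × Ell2 Γ) - (a' u + c' v, b' u + d' v) =
      (u - (a' u + c' v), v - (b' u + d' v)) := rfl
    rwa [this, h4] at h3)
  rwa [← sub_eq_zero.1 h4, ← sub_eq_zero.1 h7] at h1

end Invariant

/-! ### Graphs of unbounded operators -/

section Graph

variable {E : Type*} [AddCommGroup E] [Module ℂ E]

theorem mem_graph_pcomp {g f : E →ₗ.[ℂ] E} {x z : E} :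
    (x, z) ∈ (pcomp g f).graph ↔ ∃ y, (x, y) ∈ f.graph ∧ (y, z) ∈ g.graph := by
  constructor
  · intro h
    obtain ⟨⟨x', hx'⟩, rfl, rfl⟩ := (LinearPMap.mem_graph_iff _).1 h
    obtain ⟨h1, h2⟩ := (mem_pcomp_domain _ _ _).1 hx'
    exact ⟨f ⟨x', h1⟩, f.mem_graph ⟨x', h1⟩, g.mem_graph ⟨_, h2⟩⟩
  · rintro ⟨y, hf, hg⟩
    obtain ⟨⟨x', hx'⟩, rfl, rfl⟩ := (LinearPMap.mem_graph_iff _).1 hf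
    obtain ⟨⟨y', hy'⟩, h, rfl⟩ := (LinearPMap.mem_graph_iff _).1 hg
    dsimp only at h
    subst h
    exact (pcomp g f).mem_graph ⟨x', (mem_pcomp_domain _ _ _).2 ⟨hx', hy'⟩⟩

theorem mem_pker {F : E →ₗ.[ℂ] E} {x : E} : x ∈ pker F ↔ (x, 0) ∈ F.graph := by
  constructor
  · rintro ⟨y, hy, rfl⟩
    have h := F.mem_graph y
    rwa [show F y = 0 from hy] at h
  · intro h
    obtain ⟨y, rfl, hy⟩ := (LinearPMap.mem_graph_iff _).1 h
    exact ⟨y, hy, rfl⟩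

end Graph

theorem mem_graph_bddOp {E : Type*} [NormedAddCommGroup E] [NormedSpace ℂ E] {T : E →L[ℂ] E}
    {x y : E} : (x, y) ∈ (bddOp T).graph ↔ y = T x := by
  constructor
  · intro h
    obtain ⟨x', rfl, rfl⟩ := (LinearPMap.mem_graph_iff _).1 h
    rfl
  · rintro rfl
    exact (bddOp T).mem_graph ⟨x, Submodule.mem_top⟩

theorem isClosed_pker {E : Type*} [NormedAddCommGroup E] [NormedSpace ℂ E]
    {F : E →ₗ.[ℂ] E} (hF : F.IsClosed) : IsClosed (pker F : Set E) := by
  have h : (pker F : Set E) = (fun x : E => (x, (0 : E))) ⁻¹' (F.graph : Set (E × E)) := by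
    ext x; exact mem_pker
  rw [h]
  exact IsClosed.preimage (by fun_prop) hF

/-! ### The square of a selfadjoint operator -/

section SelfAdjoint

variable {E : Type*} [NormedAddCommGroup E] [InnerProductSpace ℂ E] [CompleteSpace E]
  {S : E →ₗ.[ℂ] E}

theorem mem_graph_of_forall_inner (hS : IsSelfAdjoint S) {y w : E}
    (h : ∀ x z, (x, z) ∈ S.graph → inner ℂ w x = inner ℂ y z) : (y, w) ∈ S.graph := by
  have h0 : S.adjoint = S := hS
  rw [← h0]
  have h1 : y ∈ S.adjoint.domain :=
    S.mem_adjoint_domain_of_exists y ⟨w, fun x => h _ _ (S.mem_graph x)⟩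
  have h2 : S.adjoint ⟨y, h1⟩ = w :=
    LinearPMap.adjoint_apply_eq hS.dense_domain _ fun x => h _ _ (S.mem_graph x)
  rw [← h2]
  exact S.adjoint.mem_graph ⟨y, h1⟩

theorem inner_graph_symm (hS : IsSelfAdjoint S) {x y x' y' : E} (h : (x, y) ∈ S.graph)
    (h' : (x', y') ∈ S.graph) : inner ℂ y x' = inner ℂ x y' := by
  have hf : S.IsFormalAdjoint S := by
    have h1 := LinearPMap.adjoint_isFormalAdjoint (T := S) hS.dense_domain
    rwa [show S.adjoint = S from hS] at h1
  obtain ⟨a, rfl, rfl⟩ := (LinearPMap.mem_graph_iff _).1 h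
  obtain ⟨b, rfl, rfl⟩ := (LinearPMap.mem_graph_iff _).1 h'
  exact hf a b

/-- The operator `1 + S²` is surjective. -/
theorem exists_add_sq_eq (hS : IsSelfAdjoint S) (z : E) :
    ∃ x y, (x, y) ∈ S.graph ∧ (y, z - x) ∈ S.graph := by
  -- If `(x, y)` is the projection of `(z, 0)` onto the graph, orthogonality of `(z - x, -y)` to the
  -- graph says that `y ∈ dom S*` and `S* y = z - x`.
  obtain ⟨a, b, c, d, h⟩ := exists_projection_entries (K := S.graph) hS.isClosed
  obtain ⟨h1, h2⟩ := h z 0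
  simp only [map_zero, add_zero, zero_sub] at h1 h2
  refine ⟨a z, b z, h1, mem_graph_of_forall_inner hS fun x w hw => ?_⟩
  have h3 := h2 _ hw
  rw [inner_neg_right, ← sub_eq_add_neg, sub_eq_zero] at h3
  rw [← inner_conj_symm, h3, inner_conj_symm]

/-- The kernel of `S` and the range of `S²` together are total. -/
theorem clm_ext_ker_range_sq (hS : IsSelfAdjoint S) {F : Type*} [NormedAddCommGroup F]
    [NormedSpace ℂ F] {T₁ T₂ : E →L[ℂ] F} (hker : ∀ x ∈ pker S, T₁ x = T₂ x)
    (hrange : ∀ x y z, (x, y) ∈ S.graph → (y, z) ∈ S.graph → T₁ z = T₂ z) : T₁ = T₂ := by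
  let M : Submodule ℂ E := LinearMap.ker ((T₁ - T₂ : E →L[ℂ] F) : E →ₗ[ℂ] F)
  have hM : ∀ {x}, x ∈ M ↔ T₁ x = T₂ x := fun {x} => by
    simp [M, LinearMap.mem_ker, sub_eq_zero]
  have hcl : IsClosed (M : Set E) := (T₁ - T₂).isClosed_ker
  have : CompleteSpace M := hcl.completeSpace_coe
  have hbot : Mᗮ = ⊥ := by
    rw [Submodule.eq_bot_iff]
    intro y hy
    rw [Submodule.mem_orthogonal] at hy
    -- With `y = x + S²x` and `S²x ⊥ y`, one gets `‖S²x‖² + ‖Sx‖² = 0`; hence `y = x` lies in the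
    -- kernel of `S`, and so in `M`.
    obtain ⟨x, w, hxw, hwy⟩ := exists_add_sq_eq hS y
    have h1 : inner ℂ (y - x) y = 0 := hy _ (hM.2 (hrange _ _ _ hxw hwy))
    have h2 : inner ℂ w w = inner ℂ (y - x) x := (inner_graph_symm hS hwy hxw).symm
    have h3 : inner ℂ (y - x) (y - x) + inner ℂ w w = 0 := by
      rw [h2, inner_sub_right, h1]; ring
    obtain ⟨h4, rfl⟩ := eq_zero_of_inner_add_inner_self h3
    have h5 : x ∈ pker S := mem_pker.2 hxw
    rw [← sub_eq_zero.1 h4] at h5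
    exact inner_self_eq_zero.1 (hy _ (hM.2 (hker _ h5)))
  rw [Submodule.orthogonal_eq_bot_iff] at hbot
  ext x
  exact hM.1 (hbot ▸ Submodule.mem_top)

end SelfAdjoint

/-! ### Polar decompositions -/

section Polar

variable {E : Type*} [NormedAddCommGroup E] [InnerProductSpace ℂ E] [CompleteSpace E]
  {F S : E →ₗ.[ℂ] E} {U : E →L[ℂ] E}

theorem IsPolarDecomp.mem_graph (h : IsPolarDecomp F U S) {x z : E} :
    (x, z) ∈ F.graph ↔ ∃ y w, (x, y) ∈ S.graph ∧ (y, w) ∈ S.graph ∧ z = U w := by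
  rw [h.eq, mem_graph_pcomp]
  constructor
  · rintro ⟨w, h1, h2⟩
    obtain ⟨y, h3, h4⟩ := mem_graph_pcomp.1 h1
    exact ⟨y, w, h3, h4, mem_graph_bddOp.1 h2⟩
  · rintro ⟨y, w, h3, h4, h5⟩
    exact ⟨w, mem_graph_pcomp.2 ⟨y, h3, h4⟩, mem_graph_bddOp.2 h5⟩

/-- `U*U` is the orthogonal projection onto `(Ker S)ᗮ`. -/
theorem IsPolarDecomp.adjoint_mul_self_sub_mem (h : IsPolarDecomp F U S) (x : E) :
    ContinuousLinearMap.adjoint U (U x) - x ∈ pker S := by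
  have : CompleteSpace (pker S) := (isClosed_pker h.pos.selfAdjoint.isClosed).completeSpace_coe
  let L : (pker S)ᗮ →ₗᵢ[ℂ] E :=
    { toLinearMap := (U : E →ₗ[ℂ] E) ∘ₗ (pker S)ᗮ.subtype
      norm_map' := fun x => h.isometric _ x.2 }
  have hU : ∀ v, U v = U ((pker S)ᗮ.starProjection v) := fun v => by
    have h1 := h.zero_on_ker _ ((pker S).starProjection_apply_mem v)
    conv_lhs => rw [← Submodule.starProjection_add_starProjection_orthogonal (K := pker S) v]
    rw [map_add, h1, zero_add]
  have hQ : ContinuousLinearMap.adjoint U (U x) = (pker S)ᗮ.starProjection x := by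
    refine ext_inner_left ℂ fun v => ?_
    rw [ContinuousLinearMap.adjoint_inner_right, hU v, hU x]
    have h2 := L.inner_map_map ⟨_, (pker S)ᗮ.starProjection_apply_mem v⟩
      ⟨_, (pker S)ᗮ.starProjection_apply_mem x⟩
    refine h2.trans ?_
    change inner ℂ ((pker S)ᗮ.starProjection v) ((pker S)ᗮ.starProjection x) = _
    rw [Submodule.inner_starProjection_left_eq_right,
      Submodule.starProjection_eq_self_iff.2 ((pker S)ᗮ.starProjection_apply_mem x)]
  rw [hQ, Submodule.starProjection_orthogonal_val, sub_sub_cancel_left]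
  exact neg_mem ((pker S).starProjection_apply_mem x)

end Polar

/-! ### Affiliated operators and their Fourier coefficients -/

section Affiliated

variable {Γ : Type*} [Group Γ] {F S : Ell2 Γ →ₗ.[ℂ] Ell2 Γ} {U : Ell2 Γ →L[ℂ] Ell2 Γ}

theorem IsAffiliated.leftInvariant (hF : IsAffiliated F) : LeftInvariant F.graph := by
  rintro γ ⟨x, y⟩ h
  obtain ⟨x, rfl, rfl⟩ := (LinearPMap.mem_graph_iff _).1 h
  obtain ⟨hx, h1⟩ := hF.commutes
    ((leftReg γ : Ell2 Γ ≃L[ℂ] Ell2 Γ) : Ell2 Γ →L[ℂ] Ell2 Γ)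
    (Set.subset_centralizer_centralizer ⟨γ, rfl⟩)
    (Unitary.linearIsometryEquiv.symm (leftReg γ)).2 x
  have h2 := F.mem_graph ⟨_, hx⟩
  rw [h1] at h2
  exact h2

theorem rightReg_delta_one (γ : Γ) : rightReg γ (delta 1) = delta γ⁻¹ := by
  rw [rightReg_delta, one_mul]

/-- On `Ker S` both compositions vanish, and on the range of `S²` the operator `U` is determined by
`F`; these two subspaces are total. -/
theorem IsPolarDecomp.commutesLeft (h : IsPolarDecomp F U S) (hF : LeftInvariant F.graph)
    (hS : LeftInvariant S.graph) : CommutesLeft U := by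
  intro γ
  let V : Ell2 Γ →L[ℂ] Ell2 Γ := ((leftReg γ : Ell2 Γ ≃L[ℂ] Ell2 Γ) : Ell2 Γ →L[ℂ] Ell2 Γ)
  suffices h1 : U ∘L V = V ∘L U from fun u => DFunLike.congr_fun h1 u
  refine clm_ext_ker_range_sq h.pos.selfAdjoint (fun x hx => ?_) fun x y z hxy hyz => ?_
  · have h1 : V x ∈ pker S := mem_pker.2 (by
      have h2 := hS γ _ (mem_pker.1 hx)
      rwa [map_zero] at h2)
    rw [ContinuousLinearMap.comp_apply, ContinuousLinearMap.comp_apply, h.zero_on_ker _ h1,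
      h.zero_on_ker _ hx, map_zero]
  · have h1 : (V x, V (U z)) ∈ F.graph := hF γ _ (h.mem_graph.2 ⟨y, z, hxy, hyz, rfl⟩)
    have h2 : (V x, U (V z)) ∈ F.graph :=
      h.mem_graph.2 ⟨V y, V z, hS γ _ hxy, hS γ _ hyz, rfl⟩
    exact F.mem_graph_snd_inj h2 h1 rfl

/-- Two vectors whose orbits have the matrix of `G` as their mutual Gram matrix define the form of
`G` on the corresponding graphs. -/
theorem inner_orbitGraph {s t : Ell2 Γ} {G : Ell2 Γ →L[ℂ] Ell2 Γ}
    (h : ∀ a b, inner ℂ (leftReg a t) (leftReg b s) = inner ℂ (delta a) (G (delta b)))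
    {u x v y : Ell2 Γ} (hv : (v, y) ∈ orbitGraph t) (hu : (u, x) ∈ orbitGraph s) :
    inner ℂ y x = inner ℂ v (G u) := by
  have key : ∀ {r : Ell2 Γ} (f : Ell2 Γ × Ell2 Γ →L[ℂ] ℂ),
      (∀ γ, f (delta γ, leftReg γ r) = 0) → ∀ w ∈ orbitGraph r, f w = 0 := by
    intro r f hf w hw
    exact orbitGraph_le (K := LinearMap.ker (f : Ell2 Γ × Ell2 Γ →ₗ[ℂ] ℂ)) f.isClosed_ker hf hw
  let p := ContinuousLinearMap.fst ℂ (Ell2 Γ) (Ell2 Γ)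
  let q := ContinuousLinearMap.snd ℂ (Ell2 Γ) (Ell2 Γ)
  -- The identity is extended from generators to closed spans one variable at a time.
  have h1 : ∀ a, inner ℂ (leftReg a t) x = inner ℂ (delta a) (G u) := fun a =>
    sub_eq_zero.1 (key (innerSL ℂ (leftReg a t) ∘L q - innerSL ℂ (delta a) ∘L G ∘L p)
      (fun b => sub_eq_zero.2 (h a b)) _ hu)
  have h2 : inner ℂ x y = inner ℂ (G u) v :=
    sub_eq_zero.1 (key (innerSL ℂ x ∘L q - innerSL ℂ (G u) ∘L p)
      (fun b => sub_eq_zero.2 (by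
        change inner ℂ x (leftReg b t) = inner ℂ (G u) (delta b)
        rw [← inner_conj_symm, h1, inner_conj_symm])) _ hv)
  rw [← inner_conj_symm, h2, inner_conj_symm]

/-- A closed operator agreeing with a bounded one on a dense set contains its whole graph, hence
equals it. -/
theorem eq_bddOp_of_subset {E : Type*} [NormedAddCommGroup E] [NormedSpace ℂ E]
    {F : E →ₗ.[ℂ] E} (hF : F.IsClosed) {G : E →L[ℂ] E} {D : Set E} (hD : Dense D)
    (h : ∀ u ∈ D, (u, G u) ∈ F.graph) : F = bddOp G := by
  have hall : ∀ u, (u, G u) ∈ F.graph := by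
    have hcl : IsClosed {u : E | (u, G u) ∈ F.graph} :=
      IsClosed.preimage (f := fun u => (u, G u)) (by fun_prop) hF
    intro u
    exact hcl.closure_subset_iff.2 h (hD u)
  refine LinearPMap.eq_of_eq_graph ?_
  ext ⟨u, z⟩
  rw [mem_graph_bddOp]
  exact ⟨fun hz => F.mem_graph_snd_inj hz (hall u) rfl, fun hz => hz ▸ hall u⟩

/-- An operator in `L¹` whose Fourier coefficients are the matrix coefficients of a bounded operator
is equal to it. -/
theorem IsL1.eq_bddOp (hF : IsL1 F) {G : Ell2 Γ →L[ℂ] Ell2 Γ}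
    (hG : ∀ a b, inner ℂ (delta a) (G (delta b)) = fourierCoeff F (b⁻¹ * a)) : F = bddOp G := by
  have hcoeff : ∀ γ, fourierCoeff F γ = formValue hF.finite_trace.choose.1
      hF.finite_trace.choose.2 (rightReg γ (delta 1)) (delta 1) := fun γ => dif_pos hF
  obtain ⟨hp, hL2⟩ := hF.finite_trace.choose_spec
  set U := hF.finite_trace.choose.1
  set S := hF.finite_trace.choose.2
  have hsa := hp.pos.selfAdjoint
  have hScl : IsClosed (S.graph : Set (Ell2 Γ × Ell2 Γ)) := hsa.isClosed
  have hSinv := hL2.affiliated.leftInvariant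
  have hU : CommutesLeft U := hp.commutesLeft hF.affiliated.leftInvariant hSinv
  set V := ContinuousLinearMap.adjoint U
  have hV : CommutesLeft V := hU.adjoint
  have hzero : ∀ y, ((0, y) : Ell2 Γ × Ell2 Γ) ∈ S.graph → y = 0 := fun y hy =>
    S.graph_fst_eq_zero_snd hy rfl
  obtain ⟨s, hs⟩ : ∃ s, (delta 1, s) ∈ S.graph := ⟨_, S.mem_graph ⟨_, hL2.delta_mem⟩⟩
  have hSs : S.graph = orbitGraph s := hSinv.eq_orbitGraph hScl hzero hs
  -- `U*δ_e` lies in `dom S` because it equals `Y δ_e` with `Y` commuting with right translations,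
  -- and such `Y` preserve the graph of `S`.
  obtain ⟨t, ht⟩ : ∃ t, (V (delta 1), t) ∈ S.graph := by
    obtain ⟨Y, hY, hYV⟩ := hV.exists_commutesRight
    exact ⟨Y s, hYV ▸ hSinv.map_mem hScl hY hs⟩
  let q := V.prodMap (ContinuousLinearMap.id ℂ (Ell2 Γ))
  -- The graph of `S U*`, a closed left invariant operator defined at `δ_e`.
  let K : Submodule ℂ (Ell2 Γ × Ell2 Γ) :=
    S.graph.comap (q : Ell2 Γ × Ell2 Γ →ₗ[ℂ] Ell2 Γ × Ell2 Γ)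
  have hKmem : ∀ v y, (v, y) ∈ K ↔ (V v, y) ∈ S.graph := fun v y => Iff.rfl
  have hKt : K = orbitGraph t := by
    refine LeftInvariant.eq_orbitGraph (hScl.preimage q.continuous) ?_ ?_ ht
    · rintro γ ⟨v, y⟩ hvy
      rw [hKmem] at hvy ⊢
      rw [hV]
      exact hSinv γ _ hvy
    · intro y hy
      rw [hKmem, map_zero] at hy
      exact hzero y hy
  have hst : ∀ a b, inner ℂ (leftReg a t) (leftReg b s) = inner ℂ (delta a) (G (delta b)) := by
    intro a b
    have h1 : (delta (a⁻¹ * b), leftReg (a⁻¹ * b) s) ∈ S.graph := hSs ▸ mem_orbitGraph s _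
    rw [hG, hcoeff, rightReg_delta_one, mul_inv_rev, inv_inv]
    obtain ⟨x, hx, hxs⟩ := (LinearPMap.mem_graph_iff _).1 h1
    obtain ⟨y, hy, hyt⟩ := (LinearPMap.mem_graph_iff _).1 ht
    have hx' : delta (a⁻¹ * b) ∈ S.domain := by
      have := x.2
      rwa [hx] at this
    have hy' : V (delta 1) ∈ S.domain := by
      have := y.2
      rwa [hy] at this
    rw [formValue, dif_pos ⟨hx', hy'⟩]
    have ex : x = ⟨_, hx'⟩ := Subtype.ext hx
    have ey : y = ⟨_, hy'⟩ := Subtype.ext hy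
    have h2 : inner ℂ (leftReg a t) (leftReg b s) = inner ℂ t (leftReg (a⁻¹ * b) s) := by
      have h3 : leftReg b s = leftReg a (leftReg (a⁻¹ * b) s) := by
        rw [← leftReg_mul, mul_inv_cancel_left]
      rw [h3, LinearIsometryEquiv.inner_map_map]
    rw [h2, ← ex, hxs]
    change inner ℂ t _ = inner ℂ (S ⟨V (delta 1), hy'⟩) _
    rw [← ey, hyt]
  have hform : ∀ {u x v y : Ell2 Γ}, (V v, y) ∈ S.graph → (u, x) ∈ S.graph →
      inner ℂ y x = inner ℂ v (G u) := by
    intro u x v y hvy hux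
    exact inner_orbitGraph hst (hKt ▸ (hKmem v y).2 hvy) (hSs ▸ hux)
  refine eq_bddOp_of_subset hF.affiliated.closed (D := (S.domain : Set (Ell2 Γ)))
    hsa.dense_domain fun u hu => ?_
  obtain ⟨x, hux⟩ := LinearPMap.mem_domain_iff.1 hu
  rw [hp.mem_graph]
  -- For `u ∈ dom S`, the form identity tested on `U w` gives `S(Su) = U*Gu`; tested on `v - UU*v`,
  -- it gives `UU*Gu = Gu`. So `Fu = Gu` on `dom S`, which is dense.
  refine ⟨x, V (G u), hux, mem_graph_of_forall_inner hsa fun w z hwz => ?_, ?_⟩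
  · have h1 : (V (U w), z) ∈ S.graph := by
      have h2 := S.graph.add_mem (mem_pker.1 (hp.adjoint_mul_self_sub_mem w)) hwz
      simpa using h2
    rw [ContinuousLinearMap.adjoint_inner_left, ← inner_conj_symm, ← hform h1 hux,
      inner_conj_symm]
  · refine ext_inner_left ℂ fun v => ?_
    have h1 : (V (v - U (V v)), (0 : Ell2 Γ)) ∈ S.graph := by
      have h2 := neg_mem (mem_pker.1 (hp.adjoint_mul_self_sub_mem (V v)))
      simpa using h2
    have h3 := hform h1 hux
    rw [inner_zero_left, inner_sub_left] at h3
    exact (sub_eq_zero.1 h3.symm).trans ((ContinuousLinearMap.adjoint_inner_right U _ _).symm.trans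
      (ContinuousLinearMap.adjoint_inner_left U _ _))

/-- An everywhere defined operator in `L¹` is bounded, and its Fourier coefficients are its matrix
coefficients. -/
theorem IsL1.exists_bddOp (hF : IsL1 F) (htop : F.domain = ⊤) :
    ∃ G : Ell2 Γ →L[ℂ] Ell2 Γ, F = bddOp G ∧
      ∀ a b, inner ℂ (delta a) (G (delta b)) = fourierCoeff F (b⁻¹ * a) := by
  let f : Ell2 Γ →ₗ[ℂ] Ell2 Γ :=
    F.toFun ∘ₗ LinearMap.codRestrict F.domain LinearMap.id fun x => htop ▸ Submodule.mem_top
  have hf : ∀ x, (x, f x) ∈ F.graph := fun x => F.mem_graph ⟨x, htop ▸ Submodule.mem_top⟩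
  have hgraph : IsClosed (f.graph : Set (Ell2 Γ × Ell2 Γ)) := by
    have h : f.graph = F.graph := by
      ext ⟨x, y⟩
      rw [LinearMap.mem_graph_iff]
      exact ⟨fun h => (show y = f x from h) ▸ hf x, fun h => F.mem_graph_snd_inj h (hf x) rfl⟩
    rw [h]
    exact hF.affiliated.closed
  let G : Ell2 Γ →L[ℂ] Ell2 Γ := ⟨f, f.continuous_of_isClosed_graph hgraph⟩
  refine ⟨G, eq_bddOp_of_subset hF.affiliated.closed dense_univ fun u _ => hf u, fun a b => ?_⟩
  rw [fourierCoeff_eq hF htop]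
  have h1 : F ⟨rightReg (b⁻¹ * a) (delta 1), htop ▸ Submodule.mem_top⟩ =
      leftReg a⁻¹ (G (delta b)) := by
    refine F.mem_graph_snd_inj (F.mem_graph _)
      (hF.affiliated.leftInvariant a⁻¹ _ (hf (delta b))) ?_
    rw [rightReg_delta_one, leftReg_delta, mul_inv_rev, inv_inv]
  rw [h1, ← LinearIsometryEquiv.inner_map_map (leftReg a) (delta 1), ← leftReg_mul,
    leftReg_delta,
    mul_inv_cancel, leftReg_one, mul_one]

end Affiliated

/-! ### The order of bounded operators -/

section Order

variable {E : Type*} [NormedAddCommGroup E] [InnerProductSpace ℂ E]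

theorem norm_inner_self_eq_sq (x : E) : ‖(inner ℂ x x : ℂ)‖ = ‖x‖ ^ 2 := by
  rw [inner_self_eq_norm_sq_to_K]
  simp

theorem inner_starProjection_self (W : Submodule ℂ E) [W.HasOrthogonalProjection] (x : E) :
    inner ℂ x (W.starProjection x) = ((‖W.starProjection x‖ ^ 2 : ℝ) : ℂ) := by
  have h := W.inner_starProjection_left_eq_right x (W.starProjection x)
  rw [Submodule.starProjection_eq_self_iff.2 (W.starProjection_apply_mem x)] at h
  rw [← h, inner_self_eq_norm_sq_to_K]
  simp

open scoped ComplexOrder in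
theorem opLE_bddOp_iff {S G : E →L[ℂ] E} :
    OpLE (bddOp S) (bddOp G) ↔ ∀ x, 0 ≤ inner ℂ x (G x - S x) := by
  constructor
  · intro h x
    obtain ⟨_, h1⟩ := h ⟨x, Submodule.mem_top⟩
    exact h1
  · intro h x
    exact ⟨Submodule.mem_top, h x⟩

theorem opLE_bddOp_iff_of_inner {S G : E →L[ℂ] E} {p q : E → ℝ}
    (hS : ∀ x, inner ℂ x (S x) = (p x : ℂ)) (hG : ∀ x, inner ℂ x (G x) = (q x : ℂ)) :
    OpLE (bddOp S) (bddOp G) ↔ ∀ x, p x ≤ q x := by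
  rw [opLE_bddOp_iff]
  refine forall_congr' fun x => ?_
  rw [inner_sub_right, hS, hG, ← Complex.ofReal_sub, Complex.zero_le_real, sub_nonneg]

theorem inner_smul_starProjection (A : ℝ) (W : Submodule ℂ E) [W.HasOrthogonalProjection] (x : E) :
    inner ℂ x (((A : ℂ) • W.starProjection) x) = ((A * ‖W.starProjection x‖ ^ 2 : ℝ) : ℂ) := by
  rw [smul_apply, inner_smul_right, inner_starProjection_self,
    ← Complex.ofReal_mul]

theorem inner_smul_id (A : ℝ) (x : E) :
    inner ℂ x (((A : ℂ) • ContinuousLinearMap.id ℂ E) x) = ((A * ‖x‖ ^ 2 : ℝ) : ℂ) := by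
  rw [smul_apply, inner_smul_right, ContinuousLinearMap.id_apply,
    inner_self_eq_norm_sq_to_K]
  simp

end Order

/-! ### Two-sided bounds for an operator and its adjoint -/

section Hilbert

variable {E F : Type*} [NormedAddCommGroup E] [InnerProductSpace ℂ E] [CompleteSpace E]
  [NormedAddCommGroup F] [InnerProductSpace ℂ F] [CompleteSpace F]

theorem adjoint_starProjection_range (T : E →L[ℂ] F) (φ : F) :
    ContinuousLinearMap.adjoint T (T.range.topologicalClosure.starProjection φ) =
      ContinuousLinearMap.adjoint T φ := by
  have h : φ - T.range.topologicalClosure.starProjection φ ∈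
      (ContinuousLinearMap.adjoint T).ker := by
    rw [← T.orthogonal_range, ← Submodule.orthogonal_closure]
    exact Submodule.sub_starProjection_mem_orthogonal _
  have h1 : ContinuousLinearMap.adjoint T (φ - T.range.topologicalClosure.starProjection φ) = 0 := h
  rw [map_sub, sub_eq_zero] at h1
  exact h1.symm

/-- Two-sided bounds of `T*` on the closure of the range of `T` pass to `T` on the closure of the
range of `T*`. -/
theorem bounds_of_adjoint_bounds (T : E →L[ℂ] F) {A B : ℝ} (hA : 0 < A) (hB : 0 ≤ B)
    (h : ∀ φ ∈ T.range.topologicalClosure, A * ‖φ‖ ^ 2 ≤ ‖ContinuousLinearMap.adjoint T φ‖ ^ 2 ∧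
      ‖ContinuousLinearMap.adjoint T φ‖ ^ 2 ≤ B * ‖φ‖ ^ 2) :
    ∀ x ∈ (ContinuousLinearMap.adjoint T).range.topologicalClosure,
      A * ‖x‖ ^ 2 ≤ ‖T x‖ ^ 2 ∧ ‖T x‖ ^ 2 ≤ B * ‖x‖ ^ 2 := by
  intro x hx
  constructor
  · let C : Set E := {y | A * ‖(inner ℂ y x : ℂ)‖ ^ 2 ≤ ‖y‖ ^ 2 * ‖T x‖ ^ 2}
    have hC : IsClosed C := isClosed_le (by fun_prop) (by fun_prop)
    have hsub : ((ContinuousLinearMap.adjoint T).range : Set E) ⊆ C := by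
      rintro _ ⟨φ, rfl⟩
      let φ' := T.range.topologicalClosure.starProjection φ
      have h1 := (h φ' (Submodule.starProjection_apply_mem _ _)).1
      change A * ‖(inner ℂ (ContinuousLinearMap.adjoint T φ) x : ℂ)‖ ^ 2 ≤
        ‖ContinuousLinearMap.adjoint T φ‖ ^ 2 * _
      rw [adjoint_starProjection_range] at h1
      rw [← adjoint_starProjection_range, ContinuousLinearMap.adjoint_inner_left,
        adjoint_starProjection_range]
      have h2 : ‖(inner ℂ φ' (T x) : ℂ)‖ ^ 2 ≤ (‖φ'‖ * ‖T x‖) ^ 2 :=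
        pow_le_pow_left₀ (norm_nonneg _) (norm_inner_le_norm _ _) 2
      calc A * ‖(inner ℂ φ' (T x) : ℂ)‖ ^ 2 ≤ A * (‖φ'‖ * ‖T x‖) ^ 2 := by gcongr
        _ = A * ‖φ'‖ ^ 2 * ‖T x‖ ^ 2 := by ring
        _ ≤ _ := by gcongr
    have hxC : x ∈ C := closure_minimal hsub hC hx
    have h1 : A * ‖(inner ℂ x x : ℂ)‖ ^ 2 ≤ ‖x‖ ^ 2 * ‖T x‖ ^ 2 := hxC
    rw [norm_inner_self_eq_sq] at h1
    rcases eq_or_ne x 0 with rfl | hx0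
    · simp
    · have h2 : 0 < ‖x‖ ^ 2 := by positivity
      nlinarith
  · have h1 := (h (T x) (Submodule.le_topologicalClosure _ ⟨x, rfl⟩)).2
    -- From `‖Tx‖² = ⟨T*Tx, x⟩`; squaring and inserting the upper bound at `φ = Tx` leaves one
    -- factor `‖Tx‖²` to cancel.
    have h2 : ‖T x‖ ^ 2 ≤ ‖x‖ * ‖ContinuousLinearMap.adjoint T (T x)‖ := by
      rw [← norm_inner_self_eq_sq (T x), ← ContinuousLinearMap.adjoint_inner_right]
      exact norm_inner_le_norm _ _
    rcases eq_or_ne (T x) 0 with h0 | h0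
    · rw [h0]; simp; positivity
    · have h3 : 0 < ‖T x‖ ^ 2 := by positivity
      have h4 : (‖T x‖ ^ 2) ^ 2 ≤ (‖x‖ * ‖ContinuousLinearMap.adjoint T (T x)‖) ^ 2 :=
        pow_le_pow_left₀ h3.le h2 2
      have h5 : ‖x‖ ^ 2 * ‖ContinuousLinearMap.adjoint T (T x)‖ ^ 2 ≤
          ‖x‖ ^ 2 * (B * ‖T x‖ ^ 2) := by gcongr
      nlinarith

/-- The one-sided statement is applied to `T` and to `T*`; the closed range of `T*` is `(Ker T)ᗮ`,
and `T` ignores the component in its kernel. -/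
theorem bounds_adjoint_iff (T : E →L[ℂ] F) {A B : ℝ} (hA : 0 < A) (hB : 0 ≤ B) :
    (∀ φ ∈ T.range.topologicalClosure, A * ‖φ‖ ^ 2 ≤ ‖ContinuousLinearMap.adjoint T φ‖ ^ 2 ∧
      ‖ContinuousLinearMap.adjoint T φ‖ ^ 2 ≤ B * ‖φ‖ ^ 2) ↔
    ∀ x, A * ‖T.kerᗮ.starProjection x‖ ^ 2 ≤ ‖T x‖ ^ 2 ∧
      ‖T x‖ ^ 2 ≤ B * ‖T.kerᗮ.starProjection x‖ ^ 2 := by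
  have hQ : ∀ x, T (T.kerᗮ.starProjection x) = T x := fun x => by
    have h1 := T.ker.starProjection_apply_mem x
    have h2 : T (T.ker.starProjection x) = 0 := h1
    rw [Submodule.starProjection_orthogonal_val, map_sub, h2, sub_zero]
  constructor
  · intro h x
    have h0 := T.kerᗮ.starProjection_apply_mem x
    have h1 := bounds_of_adjoint_bounds T hA hB h (T.kerᗮ.starProjection x)
      (by rwa [← T.orthogonal_ker])
    rwa [hQ] at h1
  · intro h
    have h1 := bounds_of_adjoint_bounds (ContinuousLinearMap.adjoint T) hA hB
    rw [ContinuousLinearMap.adjoint_adjoint] at h1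
    refine h1 fun x hx => ?_
    rw [← T.orthogonal_ker] at hx
    have h2 := h x
    rwa [Submodule.starProjection_eq_self_iff.2 hx] at h2

theorem inner_adjoint_mul_self (T : E →L[ℂ] F) (x : E) :
    inner ℂ x ((ContinuousLinearMap.adjoint T ∘L T) x) = ((‖T x‖ ^ 2 : ℝ) : ℂ) := by
  rw [ContinuousLinearMap.comp_apply, ContinuousLinearMap.adjoint_inner_right,
    inner_self_eq_norm_sq_to_K]
  simp

theorem pker_bddOp_adjoint_mul_self (T : E →L[ℂ] F) :
    pker (bddOp (ContinuousLinearMap.adjoint T ∘L T)) = T.ker := by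
  ext x
  rw [mem_pker, mem_graph_bddOp]
  constructor
  · intro h
    have h1 := inner_adjoint_mul_self T x
    rw [← h, inner_zero_right] at h1
    have h2 : ‖T x‖ ^ 2 = 0 := by exact_mod_cast h1.symm
    exact norm_eq_zero.1 (by simpa using h2)
  · intro h
    rw [ContinuousLinearMap.comp_apply, show T x = 0 from h, map_zero]

end Hilbert

/-! ### Synthesis operators -/

section Synthesis

variable {ι H : Type*} [NormedAddCommGroup H] [InnerProductSpace ℂ H]

theorem norm_sq_ell2 (u : Ell2 ι) : HasSum (fun j => ‖u j‖ ^ 2) (‖u‖ ^ 2) := by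
  have h := lp.hasSum_norm (p := 2) (by norm_num) u
  simpa using h

theorem norm_sq_sum_delta (s : Finset ι) (c : ι → ℂ) :
    ‖∑ j ∈ s, c j • (delta j : Ell2 ι)‖ ^ 2 = ∑ j ∈ s, ‖c j‖ ^ 2 := by
  classical
  have h := lp.norm_sum_single (p := 2) (E := fun _ : ι => ℂ) (by norm_num) c s
  have h1 : ∀ j, c j • (delta j : Ell2 ι) = lp.single 2 j (c j) := fun j => by
    ext k
    rw [lp.coeFn_smul, Pi.smul_apply, delta, lp.single_apply, lp.single_apply]
    by_cases hk : k = j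
    · subst hk; simp
    · simp [hk]
  simp_rw [h1]
  simpa using h

/-- The Bessel inequality follows from an upper bound for finite linear combinations. -/
theorem bessel_of_sum_le {v : ι → H} {B : ℝ} (hB : 0 ≤ B)
    (h : ∀ (s : Finset ι) (c : ι → ℂ), ‖∑ j ∈ s, c j • v j‖ ^ 2 ≤ B * ∑ j ∈ s, ‖c j‖ ^ 2)
    (φ : H) (s : Finset ι) : ∑ j ∈ s, ‖(inner ℂ (v j) φ : ℂ)‖ ^ 2 ≤ B * ‖φ‖ ^ 2 := by
  set N := ∑ j ∈ s, ‖(inner ℂ (v j) φ : ℂ)‖ ^ 2 with hN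
  -- The coefficients are the inner products themselves: then `N = ⟨w, φ⟩` and `‖w‖² ≤ BN`, so `N² ≤
  -- BN‖φ‖²`.
  have h1 := h s fun j => inner ℂ (v j) φ
  rw [← hN] at h1
  set w := ∑ j ∈ s, (inner ℂ (v j) φ : ℂ) • v j
  have h2 : (inner ℂ w φ : ℂ) = (N : ℂ) := by
    simp only [w, sum_inner, inner_smul_left, hN, Complex.ofReal_sum]
    refine Finset.sum_congr rfl fun j _ => ?_
    rw [RCLike.conj_mul]
    simp
  have hN0 : 0 ≤ N := Finset.sum_nonneg fun j _ => by positivity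
  have h3 : N ≤ ‖w‖ * ‖φ‖ := by
    have := norm_inner_le_norm (𝕜 := ℂ) w φ
    rwa [h2, Complex.norm_real, Real.norm_of_nonneg hN0] at this
  rcases hN0.eq_or_lt with h0 | h0
  · rw [← h0]; positivity
  · have h4 : N ^ 2 ≤ (‖w‖ * ‖φ‖) ^ 2 := pow_le_pow_left₀ hN0 h3 2
    have h5 : ‖w‖ ^ 2 * ‖φ‖ ^ 2 ≤ B * N * ‖φ‖ ^ 2 := by gcongr
    nlinarith

/-- A Bessel family has a bounded synthesis operator. -/
theorem exists_synthesis [CompleteSpace H] {v : ι → H} {B : ℝ} (hB : 0 ≤ B)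
    (h : ∀ (φ : H) (s : Finset ι), ∑ j ∈ s, ‖(inner ℂ (v j) φ : ℂ)‖ ^ 2 ≤ B * ‖φ‖ ^ 2) :
    ∃ T : Ell2 ι →L[ℂ] H, ∀ j, T (delta j) = v j := by
  have hmem : ∀ φ : H, Memℓp (fun j => (inner ℂ (v j) φ : ℂ)) 2 := fun φ =>
    memℓp_gen' (C := B * ‖φ‖ ^ 2) fun s => by simpa using h φ s
  let f : H →ₗ[ℂ] Ell2 ι :=
    { toFun := fun φ => ⟨fun j => inner ℂ (v j) φ, hmem φ⟩
      map_add' := fun φ φ' => by ext j; exact inner_add_right _ _ _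
      map_smul' := fun c φ => by ext j; exact inner_smul_right _ _ _ }
  have hbound : ∀ φ, ‖f φ‖ ≤ Real.sqrt B * ‖φ‖ := fun φ =>
    lp.norm_le_of_forall_sum_le (by norm_num) (by positivity) fun s => by
      have h1 := h φ s
      simpa [f, mul_pow, Real.sq_sqrt hB] using h1
  let R : H →L[ℂ] Ell2 ι := f.mkContinuous _ hbound
  refine ⟨ContinuousLinearMap.adjoint R, fun j => ?_⟩
  refine ext_inner_right ℂ fun φ => ?_
  rw [ContinuousLinearMap.adjoint_inner_left, inner_delta_left]
  rfl

theorem adjoint_synthesis_apply [CompleteSpace H] {v : ι → H} {T : Ell2 ι →L[ℂ] H}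
    (hT : ∀ j, T (delta j) = v j) (φ : H) (j : ι) :
    ContinuousLinearMap.adjoint T φ j = inner ℂ (v j) φ := by
  rw [← inner_delta_left, ContinuousLinearMap.adjoint_inner_right, hT]

theorem closure_span_eq_closure_range {v : ι → H} {T : Ell2 ι →L[ℂ] H}
    (hT : ∀ j, T (delta j) = v j) :
    (Submodule.span ℂ (Set.range v)).topologicalClosure = T.range.topologicalClosure := by
  refine le_antisymm (Submodule.topologicalClosure_mono (Submodule.span_le.2 ?_)) ?_
  · rintro _ ⟨j, rfl⟩
    exact ⟨delta j, hT j⟩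
  · refine Submodule.topologicalClosure_minimal _ ?_ (Submodule.isClosed_topologicalClosure _)
    rintro _ ⟨x, rfl⟩
    have h1 : (Submodule.span ℂ (Set.range (delta : ι → Ell2 ι))).topologicalClosure ≤
        (Submodule.span ℂ (Set.range v)).topologicalClosure.comap (T : Ell2 ι →ₗ[ℂ] H) := by
      refine Submodule.topologicalClosure_minimal _ (Submodule.span_le.2 ?_)
        ((Submodule.isClosed_topologicalClosure _).preimage T.continuous)
      rintro _ ⟨j, rfl⟩
      exact Submodule.le_topologicalClosure _ (Submodule.subset_span ⟨j, (hT j).symm⟩)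
    rw [topologicalClosure_span_delta] at h1
    exact h1 Submodule.mem_top

theorem isFrameSequence_iff [CompleteSpace H] {v : ι → H} {T : Ell2 ι →L[ℂ] H}
    (hT : ∀ j, T (delta j) = v j) (A B : ℝ) : IsFrameSequence v A B ↔
      ∀ φ ∈ T.range.topologicalClosure,
      A * ‖φ‖ ^ 2 ≤ ‖ContinuousLinearMap.adjoint T φ‖ ^ 2 ∧
      ‖ContinuousLinearMap.adjoint T φ‖ ^ 2 ≤ B * ‖φ‖ ^ 2 := by
  rw [IsFrameSequence, closure_span_eq_closure_range hT]
  refine forall₂_congr fun φ _ => ?_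
  have h := norm_sq_ell2 (ContinuousLinearMap.adjoint T φ)
  simp only [adjoint_synthesis_apply hT] at h
  rw [h.tsum_eq]
  exact and_iff_right h.summable

theorem isRieszSequence_iff {v : ι → H} {T : Ell2 ι →L[ℂ] H} (hT : ∀ j, T (delta j) = v j)
    (A B : ℝ) : IsRieszSequence v A B ↔
      ∀ x, A * ‖x‖ ^ 2 ≤ ‖T x‖ ^ 2 ∧ ‖T x‖ ^ 2 ≤ B * ‖x‖ ^ 2 := by
  have hsum : ∀ (s : Finset ι) (c : ι → ℂ),
      T (∑ j ∈ s, c j • delta j) = ∑ j ∈ s, c j • v j := fun s c => by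
    simp [hT]
  constructor
  · intro h
    have hcl : IsClosed {x | A * ‖x‖ ^ 2 ≤ ‖T x‖ ^ 2 ∧ ‖T x‖ ^ 2 ≤ B * ‖x‖ ^ 2} := by
      rw [Set.ofPred_and]
      exact (isClosed_le (by fun_prop) (by fun_prop)).inter
        (isClosed_le (by fun_prop) (by fun_prop))
    intro x
    refine hcl.closure_subset_iff.2 ?_ (dense_span_delta x)
    intro y hy
    obtain ⟨c, rfl⟩ := Finsupp.mem_span_range_iff_exists_finsupp.1 hy
    have h1 := h c
    rw [← norm_sq_sum_delta, ← hsum] at h1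
    exact h1
  · intro h c
    rw [← norm_sq_sum_delta, ← hsum]
    exact h _

theorem IsFrameSequence.exists_synthesis [CompleteSpace H] {v : ι → H} {A B : ℝ} (hB : 0 ≤ B)
    (h : IsFrameSequence v A B) : ∃ T : Ell2 ι →L[ℂ] H, ∀ j, T (delta j) = v j := by
  refine BracketFrames.exists_synthesis hB fun φ s => ?_
  -- The frame bounds hold only on the closed span, but the inner products with `v j` see only the
  -- projection of `φ` there.
  set W := (Submodule.span ℂ (Set.range v)).topologicalClosure
  have : CompleteSpace W := (Submodule.isClosed_topologicalClosure _).completeSpace_coe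
  have h1 : ∀ j, (inner ℂ (v j) φ : ℂ) = inner ℂ (v j) (W.starProjection φ) := fun j => by
    have h2 : v j ∈ W := Submodule.le_topologicalClosure _ (Submodule.subset_span ⟨j, rfl⟩)
    rw [← W.inner_starProjection_left_eq_right, Submodule.starProjection_eq_self_iff.2 h2]
  obtain ⟨h2, -, h3⟩ := h _ (W.starProjection_apply_mem φ)
  simp_rw [h1]
  calc _ ≤ _ := h2.sum_le_tsum s fun j _ => by positivity
    _ ≤ _ := h3
    _ ≤ _ := by
      gcongr
      exact W.norm_starProjection_apply_le φ

theorem IsRieszSequence.exists_synthesis [CompleteSpace H] {v : ι → H} {A B : ℝ} (hB : 0 ≤ B)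
    (h : IsRieszSequence v A B) : ∃ T : Ell2 ι →L[ℂ] H, ∀ j, T (delta j) = v j := by
  classical
  refine BracketFrames.exists_synthesis hB (bessel_of_sum_le hB fun s c => ?_)
  let d : ι →₀ ℂ := Finsupp.onFinset s (fun j => if j ∈ s then c j else 0) (by
    intro j hj
    by_contra h0
    simp [h0] at hj)
  have hd : ∀ j ∈ s, d j = c j := fun j hj => by simp [d, hj]
  have hsub : d.support ⊆ s := Finsupp.support_onFinset_subset
  have h1 := (h d).2
  have e1 : ∑ j ∈ d.support, d j • v j = ∑ j ∈ s, c j • v j :=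
    (Finset.sum_subset hsub fun j _ hj => by simp [Finsupp.notMem_support_iff.1 hj]).trans
      (Finset.sum_congr rfl fun j hj => by rw [hd j hj])
  have e2 : ∑ j ∈ d.support, ‖d j‖ ^ 2 = ∑ j ∈ s, ‖c j‖ ^ 2 :=
    (Finset.sum_subset hsub fun j _ hj => by simp [Finsupp.notMem_support_iff.1 hj]).trans
      (Finset.sum_congr rfl fun j hj => by rw [hd j hj])
  rwa [e1, e2] at h1

theorem exists_synthesis_of_gram [CompleteSpace H] {v : ι → H} {B : ℝ} (hB : 0 ≤ B)
    {G : Ell2 ι →L[ℂ] Ell2 ι}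
    (hgram : ∀ a b, inner ℂ (delta a) (G (delta b)) = (inner ℂ (v a) (v b) : ℂ))
    (h : ∀ x, (inner ℂ x (G x) : ℂ).re ≤ B * ‖x‖ ^ 2) :
    ∃ T : Ell2 ι →L[ℂ] H, ∀ j, T (delta j) = v j := by
  refine exists_synthesis hB (bessel_of_sum_le hB fun s c => ?_)
  have h1 := h (∑ j ∈ s, c j • delta j)
  rw [norm_sq_sum_delta] at h1
  refine le_trans (le_of_eq ?_) h1
  have h2 : (inner ℂ (∑ j ∈ s, c j • delta j) (G (∑ j ∈ s, c j • delta j)) : ℂ) =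
      inner ℂ (∑ j ∈ s, c j • v j) (∑ j ∈ s, c j • v j) := by
    simp only [map_sum, map_smul, sum_inner, inner_sum, inner_smul_left, inner_smul_right, hgram]
  rw [h2, inner_self_eq_norm_sq_to_K]
  simp [← Complex.ofReal_pow]

end Synthesis

/-! ### Orbits of unitary representations -/

section Orbit

variable {Γ H : Type*} [Group Γ] [NormedAddCommGroup H] [InnerProductSpace ℂ H] [CompleteSpace H]

/-- Unitarity makes the Gram matrix depend on `b⁻¹a` alone, the form in which the bracket identity
supplies it. -/
theorem inner_orbit (rep : Γ →* unitary (H →L[ℂ] H)) (ψ : H) (a b : Γ) :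
    (inner ℂ ((rep a : H →L[ℂ] H) ψ) ((rep b : H →L[ℂ] H) ψ) : ℂ) =
      inner ℂ ((rep (b⁻¹ * a) : H →L[ℂ] H) ψ) ψ := by
  rw [← Unitary.inner_map_map (rep b) ((rep (b⁻¹ * a) : H →L[ℂ] H) ψ) ψ]
  have h : rep a = rep b * rep (b⁻¹ * a) := by rw [← map_mul, mul_inv_cancel_left]
  rw [h]
  rfl

variable {F : Ell2 Γ →ₗ.[ℂ] Ell2 Γ} {v : Γ → H}

/-- The bracket is `T*T` for a bounded synthesis operator `T`. -/
theorem IsL1.eq_adjoint_mul_self (hF : IsL1 F)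
    (hv : ∀ a b, (inner ℂ (v a) (v b) : ℂ) = fourierCoeff F (b⁻¹ * a)) {T : Ell2 Γ →L[ℂ] H}
    (hT : ∀ γ, T (delta γ) = v γ) : F = bddOp (ContinuousLinearMap.adjoint T ∘L T) := by
  refine hF.eq_bddOp fun a b => ?_
  rw [ContinuousLinearMap.comp_apply, ContinuousLinearMap.adjoint_inner_right, hT, hT, hv]

/-- If the bracket is bounded above, then there is a bounded synthesis operator. -/
theorem IsL1.exists_synthesis (hF : IsL1 F)
    (hv : ∀ a b, (inner ℂ (v a) (v b) : ℂ) = fourierCoeff F (b⁻¹ * a)) {B : ℝ} (hB : 0 ≤ B)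
    {C : Ell2 Γ →L[ℂ] Ell2 Γ} (hC : ∀ x, (inner ℂ x (C x) : ℂ).re ≤ B * ‖x‖ ^ 2)
    (h : OpLE F (bddOp C)) : ∃ T : Ell2 Γ →L[ℂ] H, ∀ γ, T (delta γ) = v γ := by
  -- The right side is everywhere defined, so the order relation forces `F` to be so too; the closed
  -- graph theorem then makes it bounded.
  have htop : F.domain = ⊤ := by
    rw [eq_top_iff]
    intro x _
    exact (h ⟨x, Submodule.mem_top⟩).1
  obtain ⟨G, rfl, hG⟩ := hF.exists_bddOp htop
  refine exists_synthesis_of_gram hB (fun a b => by rw [hG, hv]) fun x => ?_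
  have h1 := (Complex.le_def.1 (opLE_bddOp_iff.1 h x)).1
  rw [inner_sub_right, Complex.sub_re, Complex.zero_re] at h1
  linarith [hC x]

theorem isFrameSequence_iff_opLE (hF : IsL1 F)
    (hv : ∀ a b, (inner ℂ (v a) (v b) : ℂ) = fourierCoeff F (b⁻¹ * a)) {A B : ℝ} (hA : 0 < A)
    (hB : 0 ≤ B) : IsFrameSequence v A B ↔
      OpLE (bddOp ((A : ℂ) • (pker F)ᗮ.starProjection)) F ∧
        OpLE F (bddOp ((B : ℂ) • (pker F)ᗮ.starProjection)) := by
  have key : ∀ T : Ell2 Γ →L[ℂ] H, (∀ γ, T (delta γ) = v γ) → (IsFrameSequence v A B ↔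
      OpLE (bddOp ((A : ℂ) • (pker F)ᗮ.starProjection)) F ∧
        OpLE F (bddOp ((B : ℂ) • (pker F)ᗮ.starProjection))) := by
    intro T hT
    obtain rfl := hF.eq_adjoint_mul_self hv hT
    rw [isFrameSequence_iff hT, bounds_adjoint_iff T hA hB,
      opLE_bddOp_iff_of_inner (inner_smul_starProjection _ _) (inner_adjoint_mul_self T),
      opLE_bddOp_iff_of_inner (inner_adjoint_mul_self T) (inner_smul_starProjection _ _),
      pker_bddOp_adjoint_mul_self, forall_and]
  constructor
  · intro h
    obtain ⟨T, hT⟩ := h.exists_synthesis hB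
    exact (key T hT).1 h
  · intro h
    obtain ⟨T, hT⟩ := hF.exists_synthesis hv hB (fun x => by
      rw [inner_smul_starProjection, Complex.ofReal_re]
      gcongr
      exact Submodule.norm_starProjection_apply_le _ x) h.2
    exact (key T hT).2 h

theorem isRieszSequence_iff_opLE (hF : IsL1 F)
    (hv : ∀ a b, (inner ℂ (v a) (v b) : ℂ) = fourierCoeff F (b⁻¹ * a)) {A B : ℝ}
    (hB : 0 ≤ B) : IsRieszSequence v A B ↔
      OpLE (bddOp ((A : ℂ) • ContinuousLinearMap.id ℂ (Ell2 Γ))) F ∧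
        OpLE F (bddOp ((B : ℂ) • ContinuousLinearMap.id ℂ (Ell2 Γ))) := by
  have key : ∀ T : Ell2 Γ →L[ℂ] H, (∀ γ, T (delta γ) = v γ) → (IsRieszSequence v A B ↔
      OpLE (bddOp ((A : ℂ) • ContinuousLinearMap.id ℂ (Ell2 Γ))) F ∧
        OpLE F (bddOp ((B : ℂ) • ContinuousLinearMap.id ℂ (Ell2 Γ)))) := by
    intro T hT
    obtain rfl := hF.eq_adjoint_mul_self hv hT
    rw [isRieszSequence_iff hT,
      opLE_bddOp_iff_of_inner (inner_smul_id _) (inner_adjoint_mul_self T),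
      opLE_bddOp_iff_of_inner (inner_adjoint_mul_self T) (inner_smul_id _), forall_and]
  constructor
  · intro h
    obtain ⟨T, hT⟩ := h.exists_synthesis hB
    exact (key T hT).1 h
  · intro h
    obtain ⟨T, hT⟩ := hF.exists_synthesis hv hB
      (fun x => by rw [inner_smul_id, Complex.ofReal_re]) h.2
    exact (key T hT).2 h

end Orbit

end BracketFrames

theorem proposition4p3 {Γ : Type*} [Group Γ] [Countable Γ]
    {H : Type*} [NormedAddCommGroup H] [InnerProductSpace ℂ H] [CompleteSpace H]
    [TopologicalSpace.SeparableSpace H]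
    (rep : Γ →* unitary (H →L[ℂ] H))
    (b : H → H → (BracketFrames.Ell2 Γ →ₗ.[ℂ] BracketFrames.Ell2 Γ))
    (hb : BracketFrames.IsBracketMap rep b)
    (ψ : H) (A B : ℝ) (hA : 0 < A) (hAB : A ≤ B) :
    (BracketFrames.IsFrameSequence (fun γ : Γ => (rep γ : H →L[ℂ] H) ψ) A B ↔
      BracketFrames.OpLE
          (BracketFrames.bddOp ((A : ℂ) • (BracketFrames.pker (b ψ ψ))ᗮ.starProjection)) (b ψ ψ) ∧
        BracketFrames.OpLE (b ψ ψ)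
          (BracketFrames.bddOp ((B : ℂ) • (BracketFrames.pker (b ψ ψ))ᗮ.starProjection))) ∧
    (BracketFrames.IsRieszSequence (fun γ : Γ => (rep γ : H →L[ℂ] H) ψ) A B ↔
      BracketFrames.OpLE
          (BracketFrames.bddOp ((A : ℂ) • ContinuousLinearMap.id ℂ (BracketFrames.Ell2 Γ)))
          (b ψ ψ) ∧
        BracketFrames.OpLE (b ψ ψ)
          (BracketFrames.bddOp ((B : ℂ) • ContinuousLinearMap.id ℂ (BracketFrames.Ell2 Γ)))) := by
  have hv : ∀ a c : Γ, (inner ℂ ((rep a : H →L[ℂ] H) ψ) ((rep c : H →L[ℂ] H) ψ) : ℂ) =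
      BracketFrames.fourierCoeff (b ψ ψ) (c⁻¹ * a) := fun a c => by
    rw [BracketFrames.inner_orbit, hb.inner_eq]
  exact ⟨BracketFrames.isFrameSequence_iff_opLE (hb.isL1 ψ ψ) hv hA (hA.le.trans hAB),
    BracketFrames.isRieszSequence_iff_opLE (hb.isL1 ψ ψ) hv (hA.le.trans hAB)⟩
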